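/- Let $\gamma\in(0,2)$ and $\lambda\ge 0$ with $\gamma<\lambda^2/3$. Consider the system for $(\Sigma_\varphi,\Omega_{\rm pf})\in\mathbb R^2$ $$\Sigma_\varphi'=-(2-q)\Sigma_\varphi+\sqrt{\tfrac32}\,\lambda\,\Omega_V,\qquad \Omega_{\rm pf}'=[2(1+q)-3\gamma]\,\Omega_{\rm pf},$$ where $\Omega_V=1-\Sigma_\varphi^2-\Omega_{\rm pf}$, $q=-1+3\Sigma_\varphi^2+\tfrac32\gamma\Omega_{\rm pf}$, and $'$ is the derivative with respect to $N\in\mathbb R$. An interior orbit is the image of a solution $N\mapsto(\Sigma_\varphi,\Omega_{\rm pf})(N)$, $N\in\mathbb R$, with $\Omega_V>0$ and $\Omega_{\rm pf}>0$ throughout. An orbit ends at (originates from) a point if its solution converges to that point as $N\to+\infty$ (as $N\to-\infty$). A set of interior orbits is called a 1-parameter set if there is a continuous curve $c:\mathbb R\to\mathbb R^2$ all of whose points lie on orbits of the set and which meets each orbit of the set for exactly one parameter value. In the coordinates $(\Sigma_\varphi,\Omega_{\rm pf})$ put $$\mathrm K_\pm=(\pm1,0),\quad \mathrm{FL}=(0,1),\quad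 \mathrm P=\Big(\tfrac{\lambda}{\sqrt6},0\Big),\quad \mathrm S=\Big(\sqrt{\tfrac32}\,\tfrac{\gamma}{\lambda},\,1-\tfrac{3\gamma}{\lambda^2}\Big).$$ Then through every point with $\Omega_V>0$, $\Omega_{\rm pf}>0$ passes exactly one interior orbit, and: (i) All interior orbits end at $\mathrm S$. (ii) Exactly one interior orbit originates from $\mathrm{FL}$. (iii) The interior orbits that originate from $\mathrm K_-$ form a 1-parameter set. (iv) If $\lambda<\sqrt6$, the interior orbits that originate from $\mathrm K_+$ also form a 1-parameter set, and exactly one interior orbit originates from $\mathrm P$. (v) If $\lambda\ge\sqrt6$, all interior orbits other than the stationary orbit $\{\mathrm S\}$ and the single one from $\mathrm{FL}$ originate from $\mathrm K_-$. -/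

import Mathlib

open Filter Topology

namespace ScalarFluid

/-! A state is a pair `x = (Σ_φ, Ω_pf)`; the parameters are `γ` and `lam` (for `λ`). -/

/-- `Ω_V = 1 - Σ_φ² - Ω_pf`. -/
def OmegaV (x : ℝ × ℝ) : ℝ := 1 - x.1 ^ 2 - x.2

/-- The deceleration parameter `q = -1 + 3 Σ_φ² + (3/2) γ Ω_pf`. -/
noncomputable def decel (γ : ℝ) (x : ℝ × ℝ) : ℝ := -1 + 3 * x.1 ^ 2 + 3 / 2 * γ * x.2

/-- The right-hand side of the dynamical system for `(Σ_φ, Ω_pf)`. -/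
noncomputable def field (γ lam : ℝ) (x : ℝ × ℝ) : ℝ × ℝ :=
  (-(2 - decel γ x) * x.1 + √(3 / 2) * lam * OmegaV x,
    (2 * (1 + decel γ x) - 3 * γ) * x.2)

/-- The interior of the state space: `Ω_V > 0` and `Ω_pf > 0`. -/
def interiorStates : Set (ℝ × ℝ) := {x | 0 < OmegaV x ∧ 0 < x.2}

/-- `x` solves the system for all e-fold times `N`. -/
def IsSolution (γ lam : ℝ) (x : ℝ → ℝ × ℝ) : Prop :=
  ∀ N : ℝ, HasDerivAt x (field γ lam (x N)) N

/-- An interior orbit: the image of a solution that lies in the interior state space. -/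
def IsInteriorOrbit (γ lam : ℝ) (O : Set (ℝ × ℝ)) : Prop :=
  ∃ x : ℝ → ℝ × ℝ, IsSolution γ lam x ∧ Set.range x = O ∧ O ⊆ interiorStates

/-- The orbit `O` ends at `p`: its solution converges to `p` as `N → +∞`. -/
def EndsAt (γ lam : ℝ) (O : Set (ℝ × ℝ)) (p : ℝ × ℝ) : Prop :=
  ∃ x : ℝ → ℝ × ℝ, IsSolution γ lam x ∧ Set.range x = O ∧ Tendsto x atTop (𝓝 p)

/-- The orbit `O` originates from `p`: its solution converges to `p` as `N → -∞`. -/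
def OriginatesFrom (γ lam : ℝ) (O : Set (ℝ × ℝ)) (p : ℝ × ℝ) : Prop :=
  ∃ x : ℝ → ℝ × ℝ, IsSolution γ lam x ∧ Set.range x = O ∧ Tendsto x atBot (𝓝 p)

/-- The interior orbits that originate from `p`. -/
def interiorOrbitsFrom (γ lam : ℝ) (p : ℝ × ℝ) : Set (Set (ℝ × ℝ)) :=
  {O | IsInteriorOrbit γ lam O ∧ OriginatesFrom γ lam O p}

/-- A set `F` of (pairwise disjoint) orbits is a 1-parameter set: a continuous curve
`s ↦ c s`, `s ∈ ℝ`, runs through the orbits of `F` only and meets each of them for exactly one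
parameter value. -/
def IsOneParameterSet (F : Set (Set (ℝ × ℝ))) : Prop :=
  ∃ c : ℝ → ℝ × ℝ, Continuous c ∧ (∀ s, ∃ O ∈ F, c s ∈ O) ∧ ∀ O ∈ F, ∃! s, c s ∈ O

/-- The kinaton fixed point with `Σ_φ = 1`. -/
def Kplus : ℝ × ℝ := (1, 0)

/-- The kinaton fixed point with `Σ_φ = -1`. -/
def Kminus : ℝ × ℝ := (-1, 0)

/-- The power-law fixed point. -/
noncomputable def P (lam : ℝ) : ℝ × ℝ := (lam / √6, 0)

/-- The Friedmann–Lemaître fixed point. -/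
def FL : ℝ × ℝ := (0, 1)

/-- The scaling fixed point. -/
noncomputable def S (γ lam : ℝ) : ℝ × ℝ := (√(3 / 2) * (γ / lam), 1 - 3 * γ / lam ^ 2)

end ScalarFluid

/-
Multiplying the field by a cutoff makes it globally Lipschitz, hence the generator of a flow, which
leaves the state space invariant because `Ω_pf` and `Ω_V` satisfy linear homogeneous equations.
Increasing along interior orbits is a product of powers of `Ω_V`, `Ω_pf` and an affine function of
`Σ_φ`; by LaSalle's principle every interior orbit tends to `S`, and the `α`-limit set of an orbit
other than `{S}` lies on the boundary. On each edge of the boundary the system is one scalar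
equation for `Σ_φ`, so an `α`-limit set confined to a strip of `Σ_φ` that contains a single zero of
these equations is an equilibrium. As `Σ_φ' > 0` where `Σ_φ ≤ 0` and `Σ_φ' < 0` where
`Σ_φ ≥ λ/√6`, the lines `Σ_φ = 0` and `Σ_φ = λ/√6` are crossed exactly once by the orbits from `K₋`
and, if `λ < √6`, by those from `K₊`, and they parametrize these orbits.

Since `log (Ω_pf / Ω_V)` changes at a rate proportional to `Σ_φ - Σ_φ(S)`, orbits started on these
two lines close to `FL` and `P` take long to bring it to a prescribed value, and meanwhile stay in
the strip between the line and `Σ_φ = Σ_φ(S)`; by compactness some orbit has been in the strip for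
all earlier times, i.e. comes from the saddle `FL` or `P`. Two solutions that emanate from a saddle
and agree in the unstable coordinate `y` coincide, because for large `K` the form `K (Δy)² - (Δx)²`
in their difference is nondecreasing. If `λ ≥ √6`, no interior orbit comes from `K₊`, where `Ω_V`
vanishes, since `Ω_V` would be nonincreasing near it; hence an orbit with `Σ_φ > 0` throughout is
`{S}` or comes from `FL`.
-/

section LipschitzFlow

variable {E : Type*} [NormedAddCommGroup E] [NormedSpace ℝ E] {v : E → E} {K : NNReal}

theorem exists_solution_on_Ioo [CompleteSpace E] {C : ℝ} (hv : LipschitzWith K v)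
    (hC : ∀ p, ‖v p‖ ≤ C) (p : E) {T : ℝ} (hT : 0 < T) :
    ∃ f : ℝ → E, f 0 = p ∧ ∀ t ∈ Set.Ioo (-T) T, HasDerivAt f (v (f t)) t := by
  have hC0 : 0 ≤ C := (norm_nonneg _).trans (hC p)
  have hpl : IsPicardLindelof (fun _ => v)
      (⟨0, by constructor <;> linarith⟩ : Set.Icc (-T) T) p
      (⟨C * T, by positivity⟩ : NNReal) 0 ⟨C, hC0⟩ K :=
    { lipschitzOnWith := fun t _ => hv.lipschitzOnWith
      continuousOn := fun x _ => continuousOn_const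
      norm_le := fun t _ x _ => hC x
      mul_max_le := by
        simp only [sub_zero, zero_sub, neg_neg, max_self, NNReal.coe_zero]
        exact le_rfl }
  obtain ⟨f, hf0, hf⟩ := hpl.exists_eq_forall_mem_Icc_hasDerivWithinAt₀
  exact ⟨f, hf0, fun t ht =>
    (hf t (Set.Ioo_subset_Icc_self ht)).hasDerivAt (Icc_mem_nhds ht.1 ht.2)⟩

theorem eqOn_Ioo_of_solutions (hv : LipschitzWith K v) {f g : ℝ → E} {T : ℝ} (hT : 0 < T)
    (hf : ∀ t ∈ Set.Ioo (-T) T, HasDerivAt f (v (f t)) t)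
    (hg : ∀ t ∈ Set.Ioo (-T) T, HasDerivAt g (v (g t)) t) (h0 : f 0 = g 0) :
    Set.EqOn f g (Set.Ioo (-T) T) :=
  ODE_solution_unique_of_mem_Ioo (v := fun _ => v) (s := fun _ => Set.univ) (K := K)
    (fun _ _ => hv.lipschitzOnWith) (Set.mem_Ioo.2 ⟨neg_lt_zero.2 hT, hT⟩)
    (fun t ht => ⟨hf t ht, trivial⟩) (fun t ht => ⟨hg t ht, trivial⟩) h0

theorem exists_global_solution [CompleteSpace E] {C : ℝ} (hv : LipschitzWith K v)
    (hC : ∀ p, ‖v p‖ ≤ C) (p : E) :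
    ∃ f : ℝ → E, f 0 = p ∧ ∀ t, HasDerivAt f (v (f t)) t := by
  choose! f hf0 hf using fun T (hT : (0 : ℝ) < T) => exists_solution_on_Ioo hv hC p hT
  have agree : ∀ R T : ℝ, 0 < R → R ≤ T → Set.EqOn (f R) (f T) (Set.Ioo (-R) R) := by
    intro R T hR hRT
    have hT := hR.trans_le hRT
    exact eqOn_Ioo_of_solutions hv hR (hf R hR)
      (fun t ht => hf T hT t (Set.Ioo_subset_Ioo (neg_le_neg hRT) hRT ht))
      ((hf0 R hR).trans (hf0 T hT).symm)
  refine ⟨fun t => f (|t| + 1) t, hf0 _ (by positivity), fun t => ?_⟩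
  have hev : (fun s => f (|s| + 1) s) =ᶠ[𝓝 t] f (|t| + 2) := by
    have hnear : ∀ᶠ s in 𝓝 t, |s| < |t| + 1 :=
      continuous_abs.continuousAt.eventually_lt_const (lt_add_one _)
    filter_upwards [hnear] with s hs
    exact agree _ _ (by positivity) (by linarith) (abs_lt.1 (lt_add_one |s|))
  have hd := hf (|t| + 2) (by positivity) t (abs_lt.1 (by linarith))
  rw [← hev.eq_of_nhds] at hd
  exact hd.congr_of_eventuallyEq hev

theorem eq_of_global_solutions (hv : LipschitzWith K v) {f g : ℝ → E}
    (hf : ∀ t, HasDerivAt f (v (f t)) t) (hg : ∀ t, HasDerivAt g (v (g t)) t)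
    (h0 : f 0 = g 0) : f = g :=
  ODE_solution_unique_univ (v := fun _ => v) (s := fun _ => Set.univ) (K := K)
    (fun _ => hv.lipschitzOnWith) (fun t => ⟨hf t, trivial⟩) (fun t => ⟨hg t, trivial⟩) h0

theorem hasDerivAt_comp_neg {f : ℝ → E} (hf : ∀ t, HasDerivAt f (v (f t)) t) (t : ℝ) :
    HasDerivAt (fun t => f (-t)) (-v (f (-t))) t := by
  simpa only [Function.comp_def, neg_smul, one_smul] using (hf (-t)).scomp t (hasDerivAt_neg t)

theorem dist_le_of_global_solutions (hv : LipschitzWith K v) {f g : ℝ → E}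
    (hf : ∀ t, HasDerivAt f (v (f t)) t) (hg : ∀ t, HasDerivAt g (v (g t)) t) (t : ℝ) :
    dist (f t) (g t) ≤ dist (f 0) (g 0) * Real.exp (K * |t|) := by
  have forward : ∀ {u : E → E} (_ : LipschitzWith K u) {f g : ℝ → E}
      (_ : ∀ t, HasDerivAt f (u (f t)) t) (_ : ∀ t, HasDerivAt g (u (g t)) t) {t : ℝ} (_ : 0 ≤ t),
      dist (f t) (g t) ≤ dist (f 0) (g 0) * Real.exp (K * t) := by
    intro u hu f g hf hg t ht
    simpa only [sub_zero] using
      dist_le_of_trajectories_ODE (v := fun _ => u) (a := 0) (b := t) (fun _ => hu)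
        (fun s _ => (hf s).continuousAt.continuousWithinAt) (fun s _ => (hf s).hasDerivWithinAt)
        (fun s _ => (hg s).continuousAt.continuousWithinAt) (fun s _ => (hg s).hasDerivWithinAt)
        le_rfl t ⟨ht, le_rfl⟩
  rcases le_total 0 t with ht | ht
  · rw [abs_of_nonneg ht]
    exact forward hv hf hg ht
  · rw [abs_of_nonpos ht]
    simpa only [neg_neg, neg_zero] using forward (u := fun p => -v p) hv.neg
      (hasDerivAt_comp_neg hf) (hasDerivAt_comp_neg hg) (neg_nonneg.2 ht)

variable [CompleteSpace E] {C : ℝ}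

/-- The global flow of a bounded Lipschitz vector field. -/
noncomputable def lipschitzFlow (hv : LipschitzWith K v) (hC : ∀ p, ‖v p‖ ≤ C) : Flow ℝ E where
  toFun t p := (exists_global_solution hv hC p).choose t
  cont' := by
    have hsol := fun p => (exists_global_solution hv hC p).choose_spec
    refine continuous_iff_continuousAt.2 fun ⟨t₀, p₀⟩ => tendsto_iff_dist_tendsto_zero.2 ?_
    refine squeeze_zero (fun _ => dist_nonneg)
      (fun q => (dist_triangle _ ((exists_global_solution hv hC p₀).choose q.1) _).trans
        (add_le_add_left (dist_le_of_global_solutions hv (hsol q.2).2 (hsol p₀).2 q.1) _)) ?_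
    simp only [fun p => (hsol p).1]
    have hcont : Continuous (exists_global_solution hv hC p₀).choose :=
      continuous_iff_continuousAt.2 fun t => ((hsol p₀).2 t).continuousAt
    refine Continuous.tendsto' (by fun_prop) _ _ ?_
    simp only [Function.uncurry_apply_pair, dist_self, zero_mul, add_zero]
  map_add' t s p := by
    have hsol := fun p => (exists_global_solution hv hC p).choose_spec
    refine congrFun (eq_of_global_solutions hv (fun r => ((hsol p).2 (r + s)).comp_add_const r s)
      (hsol _).2 ?_) t
    rw [zero_add, (hsol _).1]
  map_zero' p := (exists_global_solution hv hC p).choose_spec.1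

theorem hasDerivAt_lipschitzFlow (hv : LipschitzWith K v) (hC : ∀ p, ‖v p‖ ≤ C) (p : E) (t : ℝ) :
    HasDerivAt (fun t => lipschitzFlow hv hC t p) (v (lipschitzFlow hv hC t p)) t :=
  (exists_global_solution hv hC p).choose_spec.2 t

end LipschitzFlow

theorem apply_eq_of_mapClusterPt {ι Y Z : Type*} [TopologicalSpace Y] [TopologicalSpace Z]
    [T2Space Z] {l : Filter ι} {u : ι → Y} {F : Y → Z} {y : Y} {z : Z} (hy : MapClusterPt y l u)
    (hF : ContinuousAt F y) (h : Tendsto (F ∘ u) l (𝓝 z)) : F y = z :=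
  eq_of_nhds_neBot ((hy.continuousAt_comp hF).clusterPt.mono h)

theorem tendsto_comp_of_forall_mapClusterPt {ι Y Z : Type*} [TopologicalSpace Y]
    [TopologicalSpace Z] {l : Filter ι} {u : ι → Y} {K : Set Y} {F : Y → Z} {c : Z}
    (hK : IsCompact K) (hu : ∀ᶠ i in l, u i ∈ K) (hF : Continuous F)
    (h : ∀ q ∈ K, MapClusterPt q l u → F q = c) : Tendsto (F ∘ u) l (𝓝 c) := by
  rw [← nhdsSet_singleton]
  exact (hF.tendsto_nhdsSet fun _ => id).comp (hK.tendsto_nhdsSet_of_mapClusterPt hu h)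

section LaSalle

variable {X : Type*} [TopologicalSpace X] {ϕ : Flow ℝ X} {L : X → ℝ} {K : Set X} {p q : X}

theorem mapClusterPt_flow {l : Filter ℝ} {s : ℝ} (hl : Tendsto (s + ·) l l)
    (hq : MapClusterPt q l (ϕ · p)) : MapClusterPt (ϕ s q) l (ϕ · p) := by
  have hcomp : ϕ s ∘ (ϕ · p) = (ϕ · p) ∘ (s + ·) := funext fun t => (ϕ.map_add s t p).symm
  have hs := hq.continuousAt_comp (ϕ.continuous_toFun s).continuousAt
  rw [hcomp] at hs
  exact hs.of_comp hl

/-- The maximal invariant subset of `K`. -/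
def invariantCore (ϕ : Flow ℝ X) (K : Set X) : Set X := {q | ∀ t, ϕ t q ∈ K}

theorem isInvariant_invariantCore : IsInvariant ϕ (invariantCore ϕ K) := fun s q hq t => by
  rw [← ϕ.map_add]
  exact hq (t + s)

theorem invariantCore_subset : invariantCore ϕ K ⊆ K := fun q hq => by
  simpa only [ϕ.map_zero_apply] using hq 0

theorem isCompact_invariantCore [T2Space X] (hK : IsCompact K) : IsCompact (invariantCore ϕ K) := by
  refine hK.of_isClosed_subset ?_ invariantCore_subset
  rw [invariantCore, Set.ofPred_forall]
  exact isClosed_iInter fun t => hK.isClosed.preimage (ϕ.continuous_toFun t)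

theorem mem_invariantCore_of_mapClusterPt {l : Filter ℝ} (hl : ∀ s, Tendsto (s + ·) l l)
    (hK : IsClosed K) (hu : ∀ᶠ t in l, ϕ t p ∈ K) (hq : MapClusterPt q l (ϕ · p)) :
    q ∈ invariantCore ϕ K :=
  fun s => hK.mem_of_mapClusterPt (mapClusterPt_flow (hl s) hq) hu

/-- `L` is a (nondecreasing) Lyapunov function for the flow on a compact invariant set `K`. -/
structure IsLyapunovOn (ϕ : Flow ℝ X) (L : X → ℝ) (K : Set X) : Prop where
  isCompact : IsCompact K
  isInvariant : IsInvariant ϕ K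
  continuousAt : ∀ q ∈ K, ContinuousAt L q
  monotone : ∀ q ∈ K, Monotone fun t => L (ϕ t q)

namespace IsLyapunovOn

theorem exists_tendsto_atTop (h : IsLyapunovOn ϕ L K) (hp : p ∈ K) :
    ∃ ℓ, Tendsto (fun t => L (ϕ t p)) atTop (𝓝 ℓ) ∧ L p ≤ ℓ := by
  have hbdd : BddAbove (Set.range fun t => L (ϕ t p)) :=
    (h.isCompact.bddAbove_image fun q hq => (h.continuousAt q hq).continuousWithinAt).mono
      (Set.range_subset_iff.2 fun t => Set.mem_image_of_mem L (h.isInvariant t hp))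
  refine ⟨_, tendsto_atTop_ciSup (h.monotone p hp) hbdd, ?_⟩
  simpa only [ϕ.map_zero_apply] using le_ciSup hbdd 0

theorem exists_tendsto_atBot (h : IsLyapunovOn ϕ L K) (hp : p ∈ K) :
    ∃ ℓ, Tendsto (fun t => L (ϕ t p)) atBot (𝓝 ℓ) := by
  have hbdd : BddBelow (Set.range fun t => L (ϕ t p)) :=
    (h.isCompact.bddBelow_image fun q hq => (h.continuousAt q hq).continuousWithinAt).mono
      (Set.range_subset_iff.2 fun t => Set.mem_image_of_mem L (h.isInvariant t hp))
  exact ⟨_, tendsto_atBot_ciInf (h.monotone p hp) hbdd⟩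

variable [T2Space X]

theorem apply_flow_eq_of_mapClusterPt (h : IsLyapunovOn ϕ L K) {l : Filter ℝ} {ℓ : ℝ}
    (hl : ∀ s, Tendsto (s + ·) l l) (hp : p ∈ K) (hlim : Tendsto (fun t => L (ϕ t p)) l (𝓝 ℓ))
    (hq : MapClusterPt q l (ϕ · p)) (s : ℝ) : L (ϕ s q) = ℓ := by
  have hqK := h.isCompact.isClosed.mem_of_mapClusterPt hq (.of_forall fun t => h.isInvariant t hp)
  exact apply_eq_of_mapClusterPt (mapClusterPt_flow (hl s) hq)
    (h.continuousAt _ (h.isInvariant s hqK)) hlim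

theorem exists_apply_flow_eq (h : IsLyapunovOn ϕ L K) {l : Filter ℝ} [l.NeBot] {ℓ : ℝ}
    (hl : ∀ s, Tendsto (s + ·) l l) (hp : p ∈ K) (hlim : Tendsto (fun t => L (ϕ t p)) l (𝓝 ℓ)) :
    ∃ q ∈ K, ∀ t, L (ϕ t q) = ℓ := by
  obtain ⟨q, hqK, hq⟩ := h.isCompact.exists_mapClusterPt (u := (ϕ · p)) (f := l)
    (tendsto_principal.2 (.of_forall fun t => h.isInvariant t hp))
  exact ⟨q, hqK, h.apply_flow_eq_of_mapClusterPt hl hp hlim hq⟩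

theorem apply_flow_eq (h : IsLyapunovOn ϕ L K)
    (hconst : ∀ q ∈ K, ∀ r ∈ K, (∀ t, L (ϕ t q) = L q) → (∀ t, L (ϕ t r) = L r) → L q = L r)
    (hp : p ∈ K) (t : ℝ) : L (ϕ t p) = L p := by
  obtain ⟨a, ha, -⟩ := h.exists_tendsto_atTop hp
  obtain ⟨b, hb⟩ := h.exists_tendsto_atBot hp
  obtain ⟨q, hqK, hq⟩ := h.exists_apply_flow_eq (tendsto_atTop_add_const_left _ · tendsto_id) hp ha
  obtain ⟨r, hrK, hr⟩ := h.exists_apply_flow_eq (tendsto_atBot_add_const_left _ · tendsto_id) hp hb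
  have hq0 : L q = a := by simpa only [ϕ.map_zero_apply] using hq 0
  have hr0 : L r = b := by simpa only [ϕ.map_zero_apply] using hr 0
  have hab : a = b := by
    rw [← hq0, ← hr0]
    exact hconst q hqK r hrK (fun t => (hq t).trans hq0.symm) fun t => (hr t).trans hr0.symm
  have heq : ∀ t, L (ϕ t p) = a := fun t =>
    le_antisymm ((h.monotone p hp).ge_of_tendsto ha t)
      (hab ▸ (h.monotone p hp).le_of_tendsto hb t)
  rw [heq t, ← heq 0, ϕ.map_zero_apply]

end IsLyapunovOn

theorem eq_zero_of_hasDerivAt_comp_flow [T2Space X] {f : X → ℝ} {g : ℝ → ℝ} (hK : IsCompact K)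
    (hinv : IsInvariant ϕ K) (hf : Continuous f) (hg : Continuous g)
    (hd : ∀ q ∈ K, ∀ t, HasDerivAt (fun t => f (ϕ t q)) (g (f (ϕ t q))) t)
    (hzero : ∀ q ∈ K, ∀ r ∈ K, g (f q) = 0 → g (f r) = 0 → f q = f r) (hp : p ∈ K) :
    g (f p) = 0 := by
  have hprim : ∀ x, HasDerivAt (fun x => ∫ s in (0 : ℝ)..x, g s) (g x) x := fun x =>
    intervalIntegral.integral_hasDerivAt_right (hg.intervalIntegrable _ _)
      (hg.stronglyMeasurableAtFilter _ _) hg.continuousAt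
  -- A primitive of `g` composed with `f` is a Lyapunov function: its derivative is `(g ∘ f)²`.
  set L : X → ℝ := fun q => ∫ s in (0 : ℝ)..(f q), g s with hL
  have hLd : ∀ q ∈ K, ∀ t, HasDerivAt (fun t => L (ϕ t q)) (g (f (ϕ t q)) * g (f (ϕ t q))) t :=
    fun q hq t => (hprim _).comp t (hd q hq t)
  have lyapunov : IsLyapunovOn ϕ L K :=
    { isCompact := hK
      isInvariant := hinv
      continuousAt := fun q _ => (hprim _).continuousAt.comp hf.continuousAt
      monotone := fun q hq => monotone_of_hasDerivAt_nonneg (hLd q hq) fun t => mul_self_nonneg _ }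
  have zero_of_const : ∀ q ∈ K, (∀ t, L (ϕ t q) = L q) → g (f q) = 0 := by
    intro q hq hc
    have h0 := (hLd q hq 0).unique
      ((hasDerivAt_const 0 (L q)).congr_of_eventuallyEq (.of_forall hc))
    simpa only [ϕ.map_zero_apply, mul_self_eq_zero] using h0
  refine zero_of_const p hp (lyapunov.apply_flow_eq (fun q hq r hr hqc hrc => ?_) hp)
  simp only [hL, hzero q hq r hr (zero_of_const q hq hqc) (zero_of_const r hr hrc)]

end LaSalle

theorem hasDerivAt_fst_comp {E F : Type*} [NormedAddCommGroup E] [NormedSpace ℝ E]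
    [NormedAddCommGroup F] [NormedSpace ℝ F] {z : ℝ → E × F} {v : E × F} {t : ℝ}
    (hz : HasDerivAt z v t) : HasDerivAt (fun t => (z t).1) v.1 t :=
  (hasFDerivAt_fst (𝕜 := ℝ) (p := z t)).comp_hasDerivAt t hz

theorem hasDerivAt_snd_comp {E F : Type*} [NormedAddCommGroup E] [NormedSpace ℝ E]
    [NormedAddCommGroup F] [NormedSpace ℝ F] {z : ℝ → E × F} {v : E × F} {t : ℝ}
    (hz : HasDerivAt z v t) : HasDerivAt (fun t => (z t).2) v.2 t :=
  (hasFDerivAt_snd (𝕜 := ℝ) (p := z t)).comp_hasDerivAt t hz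

section Comparison

variable {f f' k : ℝ → ℝ} {c ε s t T : ℝ}

theorem exists_pos_mul_of_hasDerivAt_mul_self (hk : Continuous k)
    (hf : ∀ t, HasDerivAt f (k t * f t) t) (s t : ℝ) : ∃ r > 0, f t = r * f s := by
  have hprim : ∀ t, HasDerivAt (fun t => ∫ u in s..t, k u) (k t) t := fun t =>
    intervalIntegral.integral_hasDerivAt_right (hk.intervalIntegrable _ _)
      (hk.stronglyMeasurableAtFilter _ _) hk.continuousAt
  have hd : ∀ t, HasDerivAt (fun t => f t * Real.exp (-∫ u in s..t, k u)) 0 t := fun t =>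
    ((hf t).mul (hprim t).neg.exp).congr_deriv (by simp only [Pi.neg_apply]; ring)
  have hconst := is_const_of_deriv_eq_zero (fun t => (hd t).differentiableAt)
    (fun t => (hd t).deriv) t s
  simp only [intervalIntegral.integral_same, neg_zero, Real.exp_zero, mul_one] at hconst
  refine ⟨_, Real.exp_pos (∫ u in s..t, k u), ?_⟩
  rw [← hconst, mul_left_comm, ← Real.exp_add, add_neg_cancel, Real.exp_zero, mul_one]

theorem le_of_deriv_neg_at_level (hf : ∀ t, HasDerivAt f (f' t) t) (hst : s ≤ t)
    (h0 : f s ≤ c) (hb : ∀ u ∈ Set.Ico s t, f u = c → f' u < 0) : f t ≤ c :=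
  image_le_of_deriv_right_lt_deriv_boundary (B := fun _ => c) (B' := fun _ => 0)
    (fun u _ => (hf u).continuousAt.continuousWithinAt) (fun u _ => (hf u).hasDerivWithinAt) h0
    (fun u => hasDerivAt_const u c) hb ⟨hst, le_rfl⟩

theorem ge_of_deriv_pos_at_level (hf : ∀ t, HasDerivAt f (f' t) t) (hst : s ≤ t)
    (h0 : c ≤ f s) (hb : ∀ u ∈ Set.Ico s t, f u = c → 0 < f' u) : c ≤ f t :=
  neg_le_neg_iff.1 <| le_of_deriv_neg_at_level (f := fun t => -f t) (f' := fun t => -f' t)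
    (fun t => (hf t).neg) hst (neg_le_neg h0)
    fun u hu h => neg_neg_of_pos (hb u hu (neg_injective h))

theorem le_of_deriv_pos_at_level (hf : ∀ t, HasDerivAt f (f' t) t) (hst : s ≤ t)
    (h0 : f t ≤ c) (hb : ∀ u ∈ Set.Ioc s t, f u = c → 0 < f' u) : f s ≤ c := by
  have hr : ∀ u, HasDerivAt (fun u => f (-u)) (-f' (-u)) u := fun u => by
    simpa only [Function.comp_def, neg_smul, one_smul] using (hf (-u)).scomp u (hasDerivAt_neg u)
  simpa only [neg_neg] using le_of_deriv_neg_at_level hr (neg_le_neg hst)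
    (by simpa only [neg_neg] using h0)
    fun u hu h => neg_neg_of_pos (hb (-u) ⟨by linarith [hu.2], by linarith [hu.1]⟩ h)

theorem ge_of_deriv_neg_at_level (hf : ∀ t, HasDerivAt f (f' t) t) (hst : s ≤ t)
    (h0 : c ≤ f t) (hb : ∀ u ∈ Set.Ioc s t, f u = c → f' u < 0) : c ≤ f s :=
  neg_le_neg_iff.1 <| le_of_deriv_pos_at_level (f := fun t => -f t) (f' := fun t => -f' t)
    (fun t => (hf t).neg) hst (neg_le_neg h0)
    fun u hu h => neg_pos.2 (hb u hu (neg_injective h))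

theorem lt_of_deriv_pos_of_le (hf : ∀ t, HasDerivAt f (f' t) t) (hb : ∀ u, f u ≤ c → 0 < f' u)
    (ht : f t ≤ c) (hst : s < t) : f s < f t := by
  have hle : ∀ u ≤ t, f u ≤ c := fun u hu =>
    le_of_deriv_pos_at_level hf hu ht fun _ _ h => hb _ h.le
  refine strictMonoOn_of_deriv_pos (convex_Iic t)
    (fun u _ => (hf u).continuousAt.continuousWithinAt) (fun u hu => ?_) hst.le Set.self_mem_Iic hst
  rw [(hf u).deriv]
  exact hb u (hle u (interior_subset (s := Set.Iic t) hu))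

theorem existsUnique_eq_of_deriv_pos_of_le
    (hf : ∀ t, HasDerivAt f (f' t) t) (hb : ∀ u, f u ≤ c → 0 < f' u) (hs : f s ≤ c)
    (ht : c ≤ f t) : ∃! u, f u = c := by
  obtain ⟨u, hu⟩ := mem_range_of_exists_le_of_exists_ge
    (continuous_iff_continuousAt.2 fun t => (hf t).continuousAt) ⟨s, hs⟩ ⟨t, ht⟩
  refine ⟨u, hu, fun u' hu' => ?_⟩
  rcases lt_trichotomy u' u with hlt | heq | hlt
  · exact absurd (hu'.trans hu.symm) (lt_of_deriv_pos_of_le hf hb hu.le hlt).ne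
  · exact heq
  · exact absurd (hu.trans hu'.symm) (lt_of_deriv_pos_of_le hf hb hu'.le hlt).ne

theorem mul_sub_le_sub_of_le_deriv (hf : ∀ t, HasDerivAt f (f' t) t) (hst : s ≤ t)
    (hb : ∀ u ∈ Set.Icc s t, ε ≤ f' u) : ε * (t - s) ≤ f t - f s := by
  refine (convex_Icc s t).mul_sub_le_image_sub_of_le_deriv
    (fun u _ => (hf u).continuousAt.continuousWithinAt)
    (fun u _ => (hf u).differentiableAt.differentiableWithinAt) (fun u hu => ?_)
    s ⟨le_rfl, hst⟩ t ⟨hst, le_rfl⟩ hst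
  rw [(hf u).deriv]
  exact hb u (interior_subset hu)

theorem tendsto_atBot_of_le_deriv (hf : ∀ t, HasDerivAt f (f' t) t) (hε : 0 < ε)
    (hb : ∀ t ≤ T, ε ≤ f' t) : Tendsto f atBot atBot := by
  have hlin : Tendsto (fun t => f T + ε * (t - T)) atBot atBot :=
    tendsto_atBot_add_const_left _ _
      ((tendsto_atBot_add_const_right _ (-T) tendsto_id).const_mul_atBot hε)
  refine tendsto_atBot_mono' _ ?_ hlin
  filter_upwards [eventually_le_atBot T] with t ht
  linarith [mul_sub_le_sub_of_le_deriv hf ht fun u hu => hb u hu.2]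

theorem exists_first_crossing (hf : Continuous f) (h0 : c ≤ f 0)
    (hlim : ∀ᶠ t in atTop, f t < c) : ∃ T, 0 ≤ T ∧ f T = c ∧ ∀ t ∈ Set.Icc 0 T, c ≤ f t := by
  have hivt : ∀ t, 0 ≤ t → f t < c → ∃ s ∈ Set.Icc 0 t, f s = c := fun t ht hlt =>
    intermediate_value_Icc' ht hf.continuousOn ⟨hlt.le, h0⟩
  obtain ⟨t₁, ht₁, hlt₁⟩ := ((eventually_ge_atTop 0).and hlim).exists
  have hcompact : IsCompact (Set.Icc 0 t₁ ∩ {t | f t = c}) :=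
    isCompact_Icc.inter_right (isClosed_eq hf continuous_const)
  obtain ⟨T, ⟨hT, hfT⟩, hmin⟩ := hcompact.exists_isLeast (hivt t₁ ht₁ hlt₁)
  refine ⟨T, hT.1, hfT, fun t ht => ?_⟩
  by_contra! hlt
  obtain ⟨s, hs, hfs⟩ := hivt t ht.1 hlt
  have hts : t = s := (ht.2.trans (hmin ⟨⟨hs.1, hs.2.trans (ht.2.trans hT.2)⟩, hfs⟩)).antisymm hs.2
  exact (hts ▸ hfs).not_lt hlt

theorem exists_le_eq_of_tendsto_atBot {d : ℝ} (hf : Continuous f)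
    (hlim : Tendsto f atBot (𝓝 c)) (hd : c < d) (hdT : d ≤ f T) : ∃ t ≤ T, f t = d := by
  obtain ⟨s, hs, hsT⟩ := ((hlim.eventually_lt_const hd).and (eventually_le_atBot T)).exists
  obtain ⟨t, ht, rfl⟩ := intermediate_value_Icc hsT hf.continuousOn ⟨hs.le, hdT⟩
  exact ⟨t, ht.2, rfl⟩

end Comparison

section Saddle

variable {f : ℝ × ℝ → ℝ × ℝ} {f' : ℝ × ℝ →L[ℝ] ℝ × ℝ} {p : ℝ × ℝ} {μ ν b σ : ℝ}
  {z z' : ℝ → ℝ × ℝ}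

theorem exists_pos_saddle_form_le (hμ : 0 < μ) (hν : 0 < ν) (b : ℝ) :
    ∃ K > 0, ∀ u v : ℝ, u * (-μ * u + b * v) - K * (v * (ν * v)) ≤ -(μ / 2) * (u ^ 2 + v ^ 2) := by
  refine ⟨(b ^ 2 / (2 * μ) + μ / 2) / ν, by positivity, fun u v => ?_⟩
  have hK : (b ^ 2 / (2 * μ) + μ / 2) / ν * (v * (ν * v)) =
      b ^ 2 / (2 * μ) * v ^ 2 + μ / 2 * v ^ 2 := by field_simp
  have hsq : u * (-μ * u + b * v) - b ^ 2 / (2 * μ) * v ^ 2 =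
      -(μ / 2) * u ^ 2 - μ / 2 * (u - b / μ * v) ^ 2 := by
    field_simp
    ring
  nlinarith [mul_nonneg hμ.le (sq_nonneg (u - b / μ * v))]

theorem norm_sq_le_fst_sq_add_snd_sq (d : ℝ × ℝ) : ‖d‖ ^ 2 ≤ d.1 ^ 2 + d.2 ^ 2 := by
  rcases max_choice ‖d.1‖ ‖d.2‖ with hmax | hmax <;>
    rw [Prod.norm_def, hmax, Real.norm_eq_abs, sq_abs] <;>
    linarith [sq_nonneg d.1, sq_nonneg d.2]

theorem exists_eventually_saddle_form_nonpos (hf : HasStrictFDerivAt f f' p)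
    (hf' : ∀ d, f' d = (-μ * d.1 + b * d.2, ν * d.2)) (hμ : 0 < μ) (hν : 0 < ν) :
    ∃ K, ∀ᶠ q in 𝓝 (p, p), (q.1 - q.2).1 * (f q.1 - f q.2).1
      - K * ((q.1 - q.2).2 * (f q.1 - f q.2).2) ≤ 0 := by
  obtain ⟨K, hK, hform⟩ := exists_pos_saddle_form_le hμ hν b
  have hε : 0 < μ / 2 / (1 + K) := by positivity
  have hε' : μ / 2 / (1 + K) * (1 + K) = μ / 2 := div_mul_cancel₀ _ (by positivity)
  refine ⟨K, (hf.isLittleO.def hε).mono fun ⟨q, q'⟩ hq => ?_⟩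
  set d := q - q'
  set r := f q - f q' - f' d with hr
  set ε := μ / 2 / (1 + K)
  have hrem : ∀ x y : ℝ, |x| ≤ ‖d‖ → |y| ≤ ‖r‖ → |x * y| ≤ ε * (d.1 ^ 2 + d.2 ^ 2) :=
    fun x y hx hy => calc
      |x * y| = |y| * |x| := by rw [mul_comm, abs_mul]
      _ ≤ (ε * ‖d‖) * ‖d‖ :=
        mul_le_mul (hy.trans hq) hx (abs_nonneg _) ((abs_nonneg _).trans (hy.trans hq))
      _ = ε * ‖d‖ ^ 2 := by ring
      _ ≤ ε * (d.1 ^ 2 + d.2 ^ 2) :=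
        mul_le_mul_of_nonneg_left (norm_sq_le_fst_sq_add_snd_sq d) hε.le
  have h₁ := le_of_abs_le (hrem _ r.1 (norm_fst_le d) (norm_fst_le r))
  have h₂ := neg_le_of_abs_le (hrem _ r.2 (norm_snd_le d) (norm_snd_le r))
  have hsplit : f q - f q' = (-μ * d.1 + b * d.2 + r.1, ν * d.2 + r.2) := by
    rw [← sub_add_cancel (f q - f q') (f' d), ← hr, add_comm, hf']
    rfl
  calc d.1 * (f q - f q').1 - K * (d.2 * (f q - f q').2)
      = d.1 * (-μ * d.1 + b * d.2) - K * (d.2 * (ν * d.2)) + d.1 * r.1 - K * (d.2 * r.2) := by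
        rw [hsplit]
        ring
    _ ≤ -(μ / 2) * (d.1 ^ 2 + d.2 ^ 2) + ε * (d.1 ^ 2 + d.2 ^ 2)
        - K * -(ε * (d.1 ^ 2 + d.2 ^ 2)) := by
        linarith [hform d.1 d.2, mul_le_mul_of_nonneg_left h₂ hK.le]
    _ = 0 := by linear_combination (d.1 ^ 2 + d.2 ^ 2) * hε'

theorem exists_mem_nhds_eq_of_snd_eq (hf : HasStrictFDerivAt f f' p)
    (hf' : ∀ d, f' d = (-μ * d.1 + b * d.2, ν * d.2)) (hμ : 0 < μ) (hν : 0 < ν) :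
    ∃ U ∈ 𝓝 p, ∀ z z' : ℝ → ℝ × ℝ, (∀ t, HasDerivAt z (f (z t)) t) →
      (∀ t, HasDerivAt z' (f (z' t)) t) → Tendsto z atBot (𝓝 p) → Tendsto z' atBot (𝓝 p) →
      ∀ T, (∀ t ≤ T, z t ∈ U) → (∀ t ≤ T, z' t ∈ U) → (z T).2 = (z' T).2 → z T = z' T := by
  obtain ⟨K, hev⟩ := exists_eventually_saddle_form_nonpos hf hf' hμ hν
  rw [nhds_prod_eq, eventually_prod_self_iff'] at hev
  obtain ⟨U, hU, hform⟩ := hev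
  refine ⟨U, hU, fun z z' hz hz' hl hl' T hT hT' hTT => Prod.ext ?_ hTT⟩
  have hd : ∀ t, HasDerivAt (fun t => z t - z' t) (f (z t) - f (z' t)) t :=
    fun t => (hz t).sub (hz' t)
  -- Along both solutions the indefinite form `K (Δy)² - (Δx)²` is nondecreasing.
  have hE : ∀ t, HasDerivAt (fun t => K * (z t - z' t).2 ^ 2 - (z t - z' t).1 ^ 2)
      (-2 * ((z t - z' t).1 * (f (z t) - f (z' t)).1
        - K * ((z t - z' t).2 * (f (z t) - f (z' t)).2))) t := fun t =>
    ((((hasDerivAt_snd_comp (hd t)).pow 2).const_mul K).sub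
      ((hasDerivAt_fst_comp (hd t)).pow 2)).congr_deriv (by
        simp only [Nat.cast_ofNat, Nat.add_one_sub_one, pow_one]
        ring)
  have hlim : Tendsto (fun t => K * (z t - z' t).2 ^ 2 - (z t - z' t).1 ^ 2) atBot (𝓝 0) := by
    have hdiff := hl.sub hl'
    rw [sub_self] at hdiff
    simpa using ((hdiff.snd_nhds.pow 2).const_mul K).sub (hdiff.fst_nhds.pow 2)
  have hET : 0 ≤ K * (z T - z' T).2 ^ 2 - (z T - z' T).1 ^ 2 := by
    refine le_of_tendsto hlim ((eventually_le_atBot T).mono fun t ht => ?_)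
    linarith [mul_sub_le_sub_of_le_deriv (ε := 0) hE ht fun u hu => by
      linarith [hform _ (hT u hu.2) _ (hT' u hu.2)]]
  rw [Prod.snd_sub, Prod.fst_sub, hTT, sub_self] at hET
  nlinarith

/- The sign of `σ` selects the side of the saddle on which both solutions lie. -/
theorem exists_eq_of_tendsto_saddle (hf : HasStrictFDerivAt f f' p)
    (hf' : ∀ d, f' d = (-μ * d.1 + b * d.2, ν * d.2)) (hμ : 0 < μ) (hν : 0 < ν)
    (hz : ∀ t, HasDerivAt z (f (z t)) t) (hz' : ∀ t, HasDerivAt z' (f (z' t)) t)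
    (hl : Tendsto z atBot (𝓝 p)) (hl' : Tendsto z' atBot (𝓝 p))
    (hside : ∀ t, σ * p.2 < σ * (z t).2) (hside' : ∀ t, σ * p.2 < σ * (z' t).2) :
    ∃ t t', z t = z' t' := by
  obtain ⟨U, hU, huniq⟩ := exists_mem_nhds_eq_of_snd_eq hf hf' hμ hν
  obtain ⟨T, hT⟩ := eventually_atBot.1 (hl.eventually_mem hU)
  obtain ⟨T', hT'⟩ := eventually_atBot.1 (hl'.eventually_mem hU)
  have hreach : ∀ {z : ℝ → ℝ × ℝ} {T d : ℝ}, (∀ t, HasDerivAt z (f (z t)) t) →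
      Tendsto z atBot (𝓝 p) → σ * p.2 < d → d ≤ σ * (z T).2 → ∃ t ≤ T, σ * (z t).2 = d :=
    fun hz hl => exists_le_eq_of_tendsto_atBot
      (continuous_const.mul (continuous_iff_continuousAt.2 fun t => (hz t).continuousAt).snd)
      (hl.snd_nhds.const_mul σ)
  have hd := lt_min (hside T) (hside' T')
  obtain ⟨t, ht, hzt⟩ := hreach hz hl hd (min_le_left _ _)
  obtain ⟨t', ht', hzt'⟩ := hreach hz' hl' hd (min_le_right _ _)
  have hσ : σ ≠ 0 := by
    rintro rfl
    simpa using hside 0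
  have hshift : t + (t' - t) = t' := add_sub_cancel _ _
  refine ⟨t, t', ?_⟩
  have := huniq z (fun s => z' (s + (t' - t))) hz (fun s => (hz' _).comp_add_const s (t' - t)) hl
    (hl'.comp (tendsto_atBot_add_const_right _ (t' - t) tendsto_id)) t
    (fun s hs => hT s (hs.trans ht)) (fun s hs => hT' _ (by linarith))
    (by rw [hshift]; exact mul_left_cancel₀ hσ (hzt.trans hzt'.symm))
  rwa [hshift] at this

end Saddle

namespace ScalarFluid

section Parameters

/-- The parameter range `0 < γ < 2`, `γ < λ² / 3` in which `S γ lam` is an interior state. -/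
structure Admissible (γ lam : ℝ) : Prop where
  γ_pos : 0 < γ
  γ_lt_two : γ < 2
  lam_nonneg : 0 ≤ lam
  γ_lt : γ < lam ^ 2 / 3

variable {γ lam : ℝ}

theorem sqrt_mul_eq_three_mul_P_fst (lam : ℝ) : √(3 / 2) * lam = 3 * (P lam).1 := by
  have h : √(3 / 2) * √6 = 3 := by
    rw [← Real.sqrt_mul (by norm_num), show (3 / 2 : ℝ) * 6 = 3 ^ 2 by norm_num,
      Real.sqrt_sq (by norm_num)]
  rw [P]
  field_simp
  linear_combination lam * h

theorem P_fst_sq (lam : ℝ) : (P lam).1 ^ 2 = lam ^ 2 / 6 := by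
  rw [P, div_pow, Real.sq_sqrt (by norm_num)]

namespace Admissible

theorem lam_pos (h : Admissible γ lam) : 0 < lam :=
  h.lam_nonneg.lt_of_ne' fun h0 => by simpa [h0] using h.γ_pos.trans h.γ_lt

theorem P_fst_pos (h : Admissible γ lam) : 0 < (P lam).1 := div_pos h.lam_pos (by positivity)

theorem two_mul_P_fst_mul_S_fst (h : Admissible γ lam) :
    2 * (P lam).1 * (S γ lam).1 = γ := by
  have hlam := h.lam_pos.ne'
  have hsqrt : √(3 / 2) = 3 * (P lam).1 / lam := by
    rw [← sqrt_mul_eq_three_mul_P_fst, mul_div_cancel_right₀ _ hlam]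
  rw [S, hsqrt]
  field_simp
  rw [P_fst_sq]
  ring

theorem P_fst_mul_S_snd (h : Admissible γ lam) :
    (P lam).1 * (S γ lam).2 = (P lam).1 - (S γ lam).1 := by
  have hP := h.P_fst_pos.ne'
  have hS : (S γ lam).2 = 1 - γ / (2 * (P lam).1 ^ 2) := by
    rw [P_fst_sq, S]
    ring
  have hγ : γ / (2 * (P lam).1 ^ 2) = (S γ lam).1 / (P lam).1 := by
    rw [div_eq_div_iff (by positivity) hP]
    linear_combination -(P lam).1 * h.two_mul_P_fst_mul_S_fst
  rw [hS, hγ]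
  field_simp

theorem S_fst_pos (h : Admissible γ lam) : 0 < (S γ lam).1 :=
  mul_pos (by positivity) (div_pos h.γ_pos h.lam_pos)

theorem S_snd_pos (h : Admissible γ lam) : 0 < (S γ lam).2 := by
  have : 3 * γ / lam ^ 2 < 1 := by
    rw [div_lt_one (pow_pos h.lam_pos 2)]
    linarith [h.γ_lt]
  exact sub_pos.2 this

theorem S_fst_lt_P_fst (h : Admissible γ lam) : (S γ lam).1 < (P lam).1 := by
  linarith [h.P_fst_mul_S_snd, mul_pos h.P_fst_pos h.S_snd_pos]

theorem P_fst_mul_S_fst_lt_one (h : Admissible γ lam) : (P lam).1 * (S γ lam).1 < 1 := by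
  linarith [h.two_mul_P_fst_mul_S_fst, h.γ_lt_two]

theorem S_fst_lt_one (h : Admissible γ lam) : (S γ lam).1 < 1 := by
  nlinarith [h.S_fst_lt_P_fst, h.P_fst_mul_S_fst_lt_one, h.S_fst_pos]

theorem P_fst_mul_OmegaV_S (h : Admissible γ lam) :
    (P lam).1 * OmegaV (S γ lam) = (S γ lam).1 * (1 - (P lam).1 * (S γ lam).1) := by
  rw [OmegaV]
  linear_combination -h.P_fst_mul_S_snd

theorem OmegaV_S_pos (h : Admissible γ lam) : 0 < OmegaV (S γ lam) := by
  refine pos_of_mul_pos_right ?_ h.P_fst_pos.le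
  rw [h.P_fst_mul_OmegaV_S]
  exact mul_pos h.S_fst_pos (sub_pos.2 h.P_fst_mul_S_fst_lt_one)

theorem field_fst (h : Admissible γ lam) (q : ℝ × ℝ) :
    (field γ lam q).1 = 3 * (1 - q.1 ^ 2) * ((P lam).1 - q.1)
      - 3 * (P lam).1 * (1 - (S γ lam).1 * q.1) * q.2 := by
  simp only [field, decel, OmegaV, sqrt_mul_eq_three_mul_P_fst]
  linear_combination (-3 / 2) * q.1 * q.2 * h.two_mul_P_fst_mul_S_fst

theorem field_fst_eq_add_OmegaV (h : Admissible γ lam) (q : ℝ × ℝ) :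
    (field γ lam q).1 = 3 * (P lam).1 * (1 - (S γ lam).1 * q.1) * OmegaV q
      - (3 - 3 / 2 * γ) * (1 - q.1 ^ 2) * q.1 := by
  rw [h.field_fst, OmegaV]
  linear_combination (3 / 2) * (1 - q.1 ^ 2) * q.1 * h.two_mul_P_fst_mul_S_fst

end Admissible

end Parameters

section Flow

variable {γ lam : ℝ} {p q : ℝ × ℝ}

theorem continuous_OmegaV : Continuous OmegaV := by
  unfold OmegaV
  fun_prop

theorem contDiff_field (γ lam : ℝ) : ContDiff ℝ 1 (field γ lam) := by
  unfold field decel OmegaV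
  fun_prop

/-- The state space of the system, i.e. the closure of `interiorStates`. -/
def stateSpace : Set (ℝ × ℝ) := {q | 0 ≤ OmegaV q ∧ 0 ≤ q.2}

theorem interiorStates_subset_stateSpace : interiorStates ⊆ stateSpace :=
  fun _ hq => ⟨hq.1.le, hq.2.le⟩

theorem stateSpace_subset_closedBall : stateSpace ⊆ Metric.closedBall 0 1 := by
  rintro q ⟨hV, hy⟩
  rw [OmegaV] at hV
  rw [mem_closedBall_zero_iff, Prod.norm_def]
  exact max_le (abs_le_one_iff_mul_self_le_one.2 (by nlinarith))
    (abs_le.2 ⟨by linarith, by nlinarith⟩)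

theorem isCompact_stateSpace : IsCompact stateSpace :=
  (isCompact_closedBall 0 1).of_isClosed_subset
    ((isClosed_le continuous_const continuous_OmegaV).inter
      (isClosed_le continuous_const continuous_snd)) stateSpace_subset_closedBall

theorem fst_mem_Icc_of_mem_stateSpace (hq : q ∈ stateSpace) : q.1 ∈ Set.Icc (-1) 1 := by
  have := hq.1
  rw [OmegaV] at this
  exact ⟨by nlinarith [hq.2], by nlinarith [hq.2]⟩

theorem fst_mem_Ioo_of_mem_interiorStates (hq : q ∈ interiorStates) : q.1 ∈ Set.Ioo (-1) 1 := by
  have := hq.1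
  rw [OmegaV] at this
  exact ⟨by nlinarith [hq.2], by nlinarith [hq.2]⟩

/-- A smooth cutoff that equals `1` on the state space; multiplying the field by it makes the
field bounded and globally Lipschitz without changing the dynamics on the state space. -/
noncomputable def cutoff : ContDiffBump (0 : ℝ × ℝ) := ⟨1, 2, one_pos, one_lt_two⟩

theorem cutoff_eq_one (hq : q ∈ stateSpace) : cutoff q = 1 :=
  cutoff.one_of_mem_closedBall (stateSpace_subset_closedBall hq)

theorem hasCompactSupport_cutoff_smul_field (γ lam : ℝ) :
    HasCompactSupport fun q => cutoff q • field γ lam q :=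
  cutoff.hasCompactSupport.smul_right

theorem contDiff_cutoff_smul_field (γ lam : ℝ) :
    ContDiff ℝ 1 fun q => cutoff q • field γ lam q :=
  (cutoff.contDiff (n := 1)).smul (contDiff_field γ lam)

theorem exists_lipschitzWith_cutoff_smul_field (γ lam : ℝ) :
    ∃ K, LipschitzWith K fun q => cutoff q • field γ lam q :=
  (contDiff_cutoff_smul_field γ lam).lipschitzWith_of_hasCompactSupport
    (hasCompactSupport_cutoff_smul_field γ lam) one_ne_zero

/-- The flow of the cut-off field; on the state space it is the flow of the system. -/
noncomputable def flow (γ lam : ℝ) : Flow ℝ (ℝ × ℝ) :=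
  lipschitzFlow (exists_lipschitzWith_cutoff_smul_field γ lam).choose_spec
    ((hasCompactSupport_cutoff_smul_field γ lam).exists_bound_of_continuous
      (contDiff_cutoff_smul_field γ lam).continuous).choose_spec

theorem continuous_flow (γ lam : ℝ) (p : ℝ × ℝ) : Continuous (flow γ lam · p) :=
  (flow γ lam).continuous continuous_id continuous_const

theorem hasDerivAt_flow_cutoff (γ lam : ℝ) (p : ℝ × ℝ) (t : ℝ) :
    HasDerivAt (flow γ lam · p) (cutoff (flow γ lam t p) • field γ lam (flow γ lam t p)) t :=
  hasDerivAt_lipschitzFlow _ _ p t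

theorem exists_pos_mul_snd_flow (γ lam : ℝ) (p : ℝ × ℝ) (t : ℝ) :
    ∃ r > 0, (flow γ lam t p).2 = r * p.2 := by
  have hcont := continuous_flow γ lam p
  have hχ := cutoff.continuous.comp hcont
  have hd : ∀ t, HasDerivAt (fun t => (flow γ lam t p).2)
      (cutoff (flow γ lam t p) * (2 * (1 + decel γ (flow γ lam t p)) - 3 * γ)
        * (flow γ lam t p).2) t := fun t =>
    (hasDerivAt_snd_comp (hasDerivAt_flow_cutoff γ lam p t)).congr_deriv
      (mul_assoc _ _ _).symm
  have hk : Continuous fun t =>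
      cutoff (flow γ lam t p) * (2 * (1 + decel γ (flow γ lam t p)) - 3 * γ) := by
    unfold decel
    fun_prop
  simpa only [(flow γ lam).map_zero_apply] using exists_pos_mul_of_hasDerivAt_mul_self hk hd 0 t

theorem fderiv_OmegaV_field (γ lam : ℝ) (q : ℝ × ℝ) :
    -(2 * q.1 * (field γ lam q).1) - (field γ lam q).2
      = (2 * (1 + decel γ q) - 6 * (P lam).1 * q.1) * OmegaV q := by
  simp only [field, decel, OmegaV, sqrt_mul_eq_three_mul_P_fst]
  ring

theorem hasDerivAt_OmegaV_comp {z : ℝ → ℝ × ℝ} {v : ℝ × ℝ} {t : ℝ} (hz : HasDerivAt z v t) :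
    HasDerivAt (fun t => OmegaV (z t)) (-(2 * (z t).1 * v.1) - v.2) t := by
  refine ((((hasDerivAt_fst_comp hz).pow 2).const_sub 1).sub
    (hasDerivAt_snd_comp hz)).congr_deriv ?_
  simp only [Nat.cast_ofNat, Nat.add_one_sub_one, pow_one]

theorem exists_pos_mul_OmegaV_flow (γ lam : ℝ) (p : ℝ × ℝ) (t : ℝ) :
    ∃ r > 0, OmegaV (flow γ lam t p) = r * OmegaV p := by
  have hcont := continuous_flow γ lam p
  have hχ := cutoff.continuous.comp hcont
  have hd : ∀ t, HasDerivAt (fun t => OmegaV (flow γ lam t p))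
      (cutoff (flow γ lam t p) * (2 * (1 + decel γ (flow γ lam t p))
        - 6 * (P lam).1 * (flow γ lam t p).1) * OmegaV (flow γ lam t p)) t := by
    refine fun t => (hasDerivAt_OmegaV_comp (hasDerivAt_flow_cutoff γ lam p t)).congr_deriv ?_
    rw [mul_assoc (cutoff _), ← fderiv_OmegaV_field, Prod.smul_fst, Prod.smul_snd, smul_eq_mul,
      smul_eq_mul]
    ring
  have hk : Continuous fun t => cutoff (flow γ lam t p) *
      (2 * (1 + decel γ (flow γ lam t p)) - 6 * (P lam).1 * (flow γ lam t p).1) := by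
    unfold decel
    fun_prop
  simpa only [(flow γ lam).map_zero_apply] using exists_pos_mul_of_hasDerivAt_mul_self hk hd 0 t

theorem isInvariant_interiorStates (γ lam : ℝ) : IsInvariant (flow γ lam) interiorStates := by
  rintro t p ⟨hV, hy⟩
  obtain ⟨r, hr, hrV⟩ := exists_pos_mul_OmegaV_flow γ lam p t
  obtain ⟨s, hs, hsy⟩ := exists_pos_mul_snd_flow γ lam p t
  exact ⟨hrV ▸ mul_pos hr hV, hsy ▸ mul_pos hs hy⟩

theorem isInvariant_stateSpace (γ lam : ℝ) : IsInvariant (flow γ lam) stateSpace := by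
  rintro t p ⟨hV, hy⟩
  obtain ⟨r, hr, hrV⟩ := exists_pos_mul_OmegaV_flow γ lam p t
  obtain ⟨s, hs, hsy⟩ := exists_pos_mul_snd_flow γ lam p t
  exact ⟨hrV ▸ mul_nonneg hr.le hV, hsy ▸ mul_nonneg hs.le hy⟩

theorem snd_flow_eq_zero (hp : p.2 = 0) (t : ℝ) : (flow γ lam t p).2 = 0 := by
  obtain ⟨s, -, hsy⟩ := exists_pos_mul_snd_flow γ lam p t
  rw [hsy, hp, mul_zero]

theorem OmegaV_flow_eq_zero (hp : OmegaV p = 0) (t : ℝ) : OmegaV (flow γ lam t p) = 0 := by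
  obtain ⟨r, -, hrV⟩ := exists_pos_mul_OmegaV_flow γ lam p t
  rw [hrV, hp, mul_zero]

theorem hasDerivAt_flow (hp : p ∈ stateSpace) (t : ℝ) :
    HasDerivAt (flow γ lam · p) (field γ lam (flow γ lam t p)) t := by
  simpa only [cutoff_eq_one (isInvariant_stateSpace γ lam t hp), one_smul]
    using hasDerivAt_flow_cutoff γ lam p t

theorem hasDerivAt_fst_flow (hp : p ∈ stateSpace) (t : ℝ) :
    HasDerivAt (fun t => (flow γ lam t p).1) (field γ lam (flow γ lam t p)).1 t :=
  hasDerivAt_fst_comp (hasDerivAt_flow hp t)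

theorem hasDerivAt_snd_flow (hp : p ∈ stateSpace) (t : ℝ) :
    HasDerivAt (fun t => (flow γ lam t p).2) (field γ lam (flow γ lam t p)).2 t :=
  hasDerivAt_snd_comp (hasDerivAt_flow hp t)

theorem hasDerivAt_OmegaV_flow (hp : p ∈ stateSpace) (t : ℝ) :
    HasDerivAt (fun t => OmegaV (flow γ lam t p))
      ((2 * (1 + decel γ (flow γ lam t p)) - 6 * (P lam).1 * (flow γ lam t p).1)
        * OmegaV (flow γ lam t p)) t := by
  rw [← fderiv_OmegaV_field]
  exact hasDerivAt_OmegaV_comp (hasDerivAt_flow hp t)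

theorem isSolution_flow (hp : p ∈ stateSpace) : IsSolution γ lam (flow γ lam · p) :=
  hasDerivAt_flow hp

theorem IsSolution.eq_flow {z : ℝ → ℝ × ℝ} (hz : IsSolution γ lam z)
    (hmem : ∀ t, z t ∈ stateSpace) : z = (flow γ lam · (z 0)) := by
  refine eq_of_global_solutions (exists_lipschitzWith_cutoff_smul_field γ lam).choose_spec
    (fun t => ?_) (hasDerivAt_flow_cutoff γ lam (z 0)) ((flow γ lam).map_zero_apply _).symm
  rw [cutoff_eq_one (hmem t), one_smul]
  exact hz t

end Flow

section Lyapunov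

variable {γ lam : ℝ} {p q : ℝ × ℝ}

theorem Admissible.one_sub_S_fst_mul_fst_pos (h : Admissible γ lam) (hq : q ∈ stateSpace) :
    0 < 1 - (S γ lam).1 * q.1 := by
  nlinarith [h.S_fst_pos, h.S_fst_lt_one, (fst_mem_Icc_of_mem_stateSpace hq).2]

/-- A Lyapunov function of the system: the product of `Ω_V` and `Ω_pf`, raised to the powers given
by their values at `S γ lam`, and of a power of `1 - (S γ lam).1 * Σ_φ`. -/
noncomputable def lyapunov (γ lam : ℝ) (q : ℝ × ℝ) : ℝ :=
  OmegaV q ^ OmegaV (S γ lam) * q.2 ^ (S γ lam).2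
    * (1 - (S γ lam).1 * q.1) ^ (-2 * (1 - (S γ lam).1 ^ 2))

theorem lyapunov_eq_exp (h : Admissible γ lam) (hq : q ∈ interiorStates) :
    lyapunov γ lam q = Real.exp (Real.log (OmegaV q) * OmegaV (S γ lam)
      + Real.log q.2 * (S γ lam).2
      + Real.log (1 - (S γ lam).1 * q.1) * (-2 * (1 - (S γ lam).1 ^ 2))) := by
  rw [lyapunov, Real.rpow_def_of_pos hq.1, Real.rpow_def_of_pos hq.2, Real.rpow_def_of_pos
    (h.one_sub_S_fst_mul_fst_pos (interiorStates_subset_stateSpace hq)), Real.exp_add, Real.exp_add]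

theorem lyapunov_pos (h : Admissible γ lam) (hq : q ∈ interiorStates) : 0 < lyapunov γ lam q :=
  lyapunov_eq_exp h hq ▸ Real.exp_pos _

theorem lyapunov_eq_zero (h : Admissible γ lam) (hq : q ∈ stateSpace) (hq' : q ∉ interiorStates) :
    lyapunov γ lam q = 0 := by
  rcases hq.1.eq_or_lt with hV | hV
  · rw [lyapunov, ← hV, Real.zero_rpow h.OmegaV_S_pos.ne', zero_mul, zero_mul]
  · rw [lyapunov, ← hq.2.antisymm (not_lt.1 fun hy => hq' ⟨hV, hy⟩),
      Real.zero_rpow h.S_snd_pos.ne', mul_zero, zero_mul]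

theorem continuousAt_lyapunov (h : Admissible γ lam) (hq : q ∈ stateSpace) :
    ContinuousAt (lyapunov γ lam) q :=
  ((continuous_OmegaV.continuousAt.rpow_const (.inr h.OmegaV_S_pos.le)).mul
    (continuousAt_snd.rpow_const (.inr h.S_snd_pos.le))).mul
      ((continuousAt_const.sub (continuousAt_const.mul continuousAt_fst)).rpow_const
        (.inl (h.one_sub_S_fst_mul_fst_pos hq).ne'))

theorem lyapunov_rate_eq (h : Admissible γ lam) (hq : q ∈ stateSpace) :
    (2 * (1 + decel γ q) - 6 * (P lam).1 * q.1) * OmegaV (S γ lam)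
        + (2 * (1 + decel γ q) - 3 * γ) * (S γ lam).2
        + -((S γ lam).1 * (field γ lam q).1) / (1 - (S γ lam).1 * q.1)
          * (-2 * (1 - (S γ lam).1 ^ 2))
      = 3 * (2 - γ) * (q.1 - (S γ lam).1) ^ 2 / (1 - (S γ lam).1 * q.1) := by
  have hd : 1 - q.1 * (S γ lam).1 ≠ 0 := mul_comm q.1 _ ▸ (h.one_sub_S_fst_mul_fst_pos hq).ne'
  have hP := h.P_fst_pos.ne'
  have hV : OmegaV (S γ lam) = (S γ lam).1 * (1 - (P lam).1 * (S γ lam).1) / (P lam).1 :=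
    eq_div_of_mul_eq hP ((mul_comm _ _).trans h.P_fst_mul_OmegaV_S)
  have hy : (S γ lam).2 = ((P lam).1 - (S γ lam).1) / (P lam).1 :=
    eq_div_of_mul_eq hP ((mul_comm _ _).trans h.P_fst_mul_S_snd)
  have hγ := h.two_mul_P_fst_mul_S_fst
  rw [h.field_fst, hV, hy, decel]
  field_simp
  clear h hq hV hy
  generalize (P lam).1 = π, (S γ lam).1 = σ at *
  subst hγ
  ring

theorem hasDerivAt_lyapunov_flow (h : Admissible γ lam) (hp : p ∈ interiorStates) (t : ℝ) :
    HasDerivAt (fun t => lyapunov γ lam (flow γ lam t p))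
      (lyapunov γ lam (flow γ lam t p) * (3 * (2 - γ) * ((flow γ lam t p).1 - (S γ lam).1) ^ 2
        / (1 - (S γ lam).1 * (flow γ lam t p).1))) t := by
  have hp' := interiorStates_subset_stateSpace hp
  have hmem := fun t => isInvariant_interiorStates γ lam t hp
  have hmem' := isInvariant_stateSpace γ lam t hp'
  have hlogV := (hasDerivAt_OmegaV_flow (lam := lam) (γ := γ) hp' t).log (hmem t).1.ne'
  have hlogy := (hasDerivAt_snd_flow (lam := lam) (γ := γ) hp' t).log (hmem t).2.ne'
  have hlogx := (((hasDerivAt_fst_flow hp' t).const_mul (S γ lam).1).const_sub 1).log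
    (h.one_sub_S_fst_mul_fst_pos hmem').ne'
  rw [mul_div_cancel_right₀ _ (hmem t).1.ne'] at hlogV
  rw [field, mul_div_cancel_right₀ _ (hmem t).2.ne'] at hlogy
  simp only [fun t => lyapunov_eq_exp h (hmem t)]
  rw [← lyapunov_rate_eq h hmem']
  exact (((hlogV.mul_const _).add (hlogy.mul_const _)).add (hlogx.mul_const _)).exp

theorem lyapunov_rate_nonneg (h : Admissible γ lam) (hq : q ∈ stateSpace) :
    0 ≤ 3 * (2 - γ) * (q.1 - (S γ lam).1) ^ 2 / (1 - (S γ lam).1 * q.1) :=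
  div_nonneg (mul_nonneg (by linarith [h.γ_lt_two]) (sq_nonneg _))
    (h.one_sub_S_fst_mul_fst_pos hq).le

theorem mem_interiorStates_of_flow_mem {t : ℝ} (ht : flow γ lam t p ∈ interiorStates) :
    p ∈ interiorStates := by
  simpa only [← (flow γ lam).map_add, neg_add_cancel, (flow γ lam).map_zero_apply]
    using isInvariant_interiorStates γ lam (-t) ht

theorem isLyapunovOn_lyapunov (h : Admissible γ lam) :
    IsLyapunovOn (flow γ lam) (lyapunov γ lam) stateSpace where
  isCompact := isCompact_stateSpace
  isInvariant := isInvariant_stateSpace γ lam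
  continuousAt _ hq := continuousAt_lyapunov h hq
  monotone q hq := by
    by_cases hq' : q ∈ interiorStates
    · exact monotone_of_hasDerivAt_nonneg (hasDerivAt_lyapunov_flow h hq') fun t =>
        mul_nonneg (lyapunov_pos h (isInvariant_interiorStates γ lam t hq')).le
          (lyapunov_rate_nonneg h (isInvariant_stateSpace γ lam t hq))
    · have hzero : ∀ t, lyapunov γ lam (flow γ lam t q) = 0 := fun t =>
        lyapunov_eq_zero h (isInvariant_stateSpace γ lam t hq)
          fun ht => hq' (mem_interiorStates_of_flow_mem ht)
      exact fun s t _ => ((hzero s).trans (hzero t).symm).le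

theorem eq_S_of_lyapunov_flow_const (h : Admissible γ lam) (hp : p ∈ interiorStates) {ℓ : ℝ}
    (hconst : ∀ t, lyapunov γ lam (flow γ lam t p) = ℓ) : p = S γ lam := by
  have hp' := interiorStates_subset_stateSpace hp
  have hx : ∀ t, (flow γ lam t p).1 = (S γ lam).1 := by
    intro t
    have hzero := (hasDerivAt_lyapunov_flow h hp t).unique
      ((hasDerivAt_const t ℓ).congr_of_eventuallyEq (.of_forall hconst))
    have hden := h.one_sub_S_fst_mul_fst_pos (isInvariant_stateSpace γ lam t hp')
    have hγ : 0 < 3 * (2 - γ) := by linarith [h.γ_lt_two]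
    simpa only [mul_eq_zero, div_eq_zero_iff, hden.ne', hγ.ne', sub_eq_zero, false_or, or_false,
      (lyapunov_pos h (isInvariant_interiorStates γ lam t hp)).ne', pow_eq_zero_iff two_ne_zero]
      using hzero
  have hfield : (field γ lam p).1 = 0 := by
    have hzero := (hasDerivAt_fst_flow hp' 0).unique
      ((hasDerivAt_const 0 (S γ lam).1).congr_of_eventuallyEq (.of_forall hx))
    rwa [(flow γ lam).map_zero_apply] at hzero
  have hx0 : p.1 = (S γ lam).1 := by simpa only [(flow γ lam).map_zero_apply] using hx 0
  have hS : 1 - (S γ lam).1 ^ 2 ≠ 0 := by nlinarith [h.S_fst_pos, h.S_fst_lt_one]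
  refine Prod.ext hx0 (mul_left_cancel₀ (mul_ne_zero hS h.P_fst_pos.ne') ?_)
  rw [h.field_fst, hx0] at hfield
  linear_combination (-1 / 3) * hfield - (1 - (S γ lam).1 ^ 2) * h.P_fst_mul_S_snd

theorem tendsto_flow_S (h : Admissible γ lam) (hp : p ∈ interiorStates) :
    Tendsto (flow γ lam · p) atTop (𝓝 (S γ lam)) := by
  have hp' := interiorStates_subset_stateSpace hp
  have hlyap := isLyapunovOn_lyapunov h
  obtain ⟨ℓ, hℓ, hpℓ⟩ := hlyap.exists_tendsto_atTop hp'
  refine isCompact_stateSpace.tendsto_nhds_of_unique_mapClusterPt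
    (.of_forall fun t => isInvariant_stateSpace γ lam t hp') fun q hq hcl => ?_
  have hconst := hlyap.apply_flow_eq_of_mapClusterPt (tendsto_atTop_add_const_left _ · tendsto_id)
    hp' hℓ hcl
  refine eq_S_of_lyapunov_flow_const h (not_not.1 fun hq' => ?_) hconst
  have hq0 := hconst 0
  rw [(flow γ lam).map_zero_apply, lyapunov_eq_zero h hq hq'] at hq0
  linarith [lyapunov_pos h hp]

theorem S_mem_interiorStates (h : Admissible γ lam) : S γ lam ∈ interiorStates :=
  ⟨h.OmegaV_S_pos, h.S_snd_pos⟩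

theorem not_mem_interiorStates_of_mapClusterPt_atBot (h : Admissible γ lam)
    (hp : p ∈ interiorStates) (hpS : p ≠ S γ lam) (hq : MapClusterPt q atBot (flow γ lam · p)) :
    q ∉ interiorStates := by
  intro hq'
  have hp' := interiorStates_subset_stateSpace hp
  have hlyap := isLyapunovOn_lyapunov h
  obtain ⟨ℓ, hℓ⟩ := hlyap.exists_tendsto_atBot hp'
  have hconst := hlyap.apply_flow_eq_of_mapClusterPt (tendsto_atBot_add_const_left _ · tendsto_id)
    hp' hℓ hq
  have hqS := eq_S_of_lyapunov_flow_const h hq' hconst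
  have hℓS : ℓ = lyapunov γ lam (S γ lam) := by
    simpa only [(flow γ lam).map_zero_apply, hqS] using (hconst 0).symm
  have hS := interiorStates_subset_stateSpace (S_mem_interiorStates h)
  have htop : Tendsto (fun t => lyapunov γ lam (flow γ lam t p)) atTop (𝓝 ℓ) :=
    hℓS ▸ (continuousAt_lyapunov h hS).tendsto.comp (tendsto_flow_S h hp)
  exact hpS (eq_S_of_lyapunov_flow_const h hp fun t =>
    le_antisymm ((hlyap.monotone p hp').ge_of_tendsto htop t)
      ((hlyap.monotone p hp').le_of_tendsto hℓ t))

end Lyapunov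

section AlphaLimit

variable {γ lam l u : ℝ} {p q r : ℝ × ℝ}

theorem tendsto_const_add_atBot (s : ℝ) : Tendsto (s + ·) atBot atBot :=
  tendsto_atBot_add_const_left _ s tendsto_id

theorem zero_of_mem_invariantCore_snd_eq_zero (h : Admissible γ lam)
    (huniq : ∀ a ∈ Set.Icc l u, ∀ b ∈ Set.Icc l u, (1 - a ^ 2) * ((P lam).1 - a) = 0 →
      (1 - b ^ 2) * ((P lam).1 - b) = 0 → a = b)
    (hq : q ∈ invariantCore (flow γ lam) (stateSpace ∩ {q | q.2 = 0 ∧ q.1 ∈ Set.Icc l u})) :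
    (1 - q.1 ^ 2) * ((P lam).1 - q.1) = 0 := by
  have hclosed : IsClosed {q : ℝ × ℝ | q.2 = 0 ∧ q.1 ∈ Set.Icc l u} :=
    (isClosed_eq continuous_snd continuous_const).inter (isClosed_Icc.preimage continuous_fst)
  have hzero := eq_zero_of_hasDerivAt_comp_flow (f := Prod.fst)
    (g := fun x => 3 * ((1 - x ^ 2) * ((P lam).1 - x)))
    (isCompact_invariantCore (isCompact_stateSpace.inter_right hclosed))
    isInvariant_invariantCore continuous_fst (by fun_prop)
    (fun r hr t => (hasDerivAt_fst_flow (invariantCore_subset hr).1 t).congr_deriv ?_)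
    (fun a ha b hb haz hbz => huniq _ (invariantCore_subset ha).2.2 _ (invariantCore_subset hb).2.2
      (by linarith) (by linarith)) hq
  · exact (mul_eq_zero.1 hzero).resolve_left three_ne_zero
  · rw [h.field_fst, (hr t).2.1, mul_zero, sub_zero, mul_assoc]

theorem zero_of_mem_invariantCore_OmegaV_eq_zero (h : Admissible γ lam)
    (huniq : ∀ a ∈ Set.Icc l u, ∀ b ∈ Set.Icc l u, (1 - a ^ 2) * a = 0 →
      (1 - b ^ 2) * b = 0 → a = b)
    (hq : q ∈ invariantCore (flow γ lam) (stateSpace ∩ {q | OmegaV q = 0 ∧ q.1 ∈ Set.Icc l u})) :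
    (1 - q.1 ^ 2) * q.1 = 0 := by
  have hγ : -(3 - 3 / 2 * γ) ≠ 0 := by linarith [h.γ_lt_two]
  have hclosed : IsClosed {q : ℝ × ℝ | OmegaV q = 0 ∧ q.1 ∈ Set.Icc l u} :=
    (isClosed_eq continuous_OmegaV continuous_const).inter (isClosed_Icc.preimage continuous_fst)
  have hzero := eq_zero_of_hasDerivAt_comp_flow (f := Prod.fst)
    (g := fun x => -(3 - 3 / 2 * γ) * ((1 - x ^ 2) * x))
    (isCompact_invariantCore (isCompact_stateSpace.inter_right hclosed))
    isInvariant_invariantCore continuous_fst (by fun_prop)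
    (fun r hr t => (hasDerivAt_fst_flow (invariantCore_subset hr).1 t).congr_deriv ?_)
    (fun a ha b hb haz hbz => huniq _ (invariantCore_subset ha).2.2 _ (invariantCore_subset hb).2.2
      ((mul_eq_zero.1 haz).resolve_left hγ) ((mul_eq_zero.1 hbz).resolve_left hγ)) hq
  · exact (mul_eq_zero.1 hzero).resolve_left hγ
  · rw [h.field_fst_eq_add_OmegaV, (hr t).2.1]
    ring

theorem snd_eq_zero_or_OmegaV_eq_zero (hq : q ∈ stateSpace) (hq' : q ∉ interiorStates) :
    q.2 = 0 ∨ OmegaV q = 0 := by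
  by_contra! hne
  exact hq' ⟨hq.1.lt_of_ne' hne.2, hq.2.lt_of_ne' hne.1⟩

theorem fst_mem_Icc_flow_of_mapClusterPt (hx : ∀ᶠ t in atBot, (flow γ lam t p).1 ∈ Set.Icc l u)
    (hq : MapClusterPt q atBot (flow γ lam · p)) (t : ℝ) : (flow γ lam t q).1 ∈ Set.Icc l u :=
  mem_invariantCore_of_mapClusterPt (K := Prod.fst ⁻¹' Set.Icc l u) tendsto_const_add_atBot
    (isClosed_Icc.preimage continuous_fst) hx hq t

-- On each edge the system reduces to one equation for `Σ_φ`; the two right-hand sides are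
-- multiples of the polynomials in `hy` (`Ω_pf = 0`) and `hV` (`Ω_V = 0`).
theorem tendsto_flow_atBot_of_fst_mem_Icc (h : Admissible γ lam) (hp : p ∈ interiorStates)
    (hpS : p ≠ S γ lam) (hx : ∀ᶠ t in atBot, (flow γ lam t p).1 ∈ Set.Icc l u)
    (hy : ∀ a ∈ Set.Icc l u, (1 - a ^ 2) * ((P lam).1 - a) = 0 → (a, 0) = r)
    (hV : ∀ a ∈ Set.Icc l u, (1 - a ^ 2) * a = 0 → (a, 1 - a ^ 2) = r) :
    Tendsto (flow γ lam · p) atBot (𝓝 r) := by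
  have hp' := interiorStates_subset_stateSpace hp
  refine isCompact_stateSpace.tendsto_nhds_of_unique_mapClusterPt
    (.of_forall fun t => isInvariant_stateSpace γ lam t hp') fun q hq hcl => ?_
  have hqx := fst_mem_Icc_flow_of_mapClusterPt hx hcl
  have hqx0 : q.1 ∈ Set.Icc l u := by simpa only [(flow γ lam).map_zero_apply] using hqx 0
  have hqt := fun t => isInvariant_stateSpace γ lam t hq
  rcases snd_eq_zero_or_OmegaV_eq_zero hq
    (not_mem_interiorStates_of_mapClusterPt_atBot h hp hpS hcl) with hq0 | hq0
  · have hzero := zero_of_mem_invariantCore_snd_eq_zero h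
      (fun a ha b hb haz hbz => congrArg Prod.fst ((hy a ha haz).trans (hy b hb hbz).symm))
      fun t => ⟨hqt t, snd_flow_eq_zero hq0 t, hqx t⟩
    exact (Prod.ext rfl hq0 : q = (q.1, 0)).trans (hy q.1 hqx0 hzero)
  · have hzero := zero_of_mem_invariantCore_OmegaV_eq_zero h
      (fun a ha b hb haz hbz => congrArg Prod.fst ((hV a ha haz).trans (hV b hb hbz).symm))
      fun t => ⟨hqt t, OmegaV_flow_eq_zero hq0 t, hqx t⟩
    exact (Prod.ext rfl (sub_eq_zero.1 hq0).symm : q = (q.1, 1 - q.1 ^ 2)).trans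
      (hV q.1 hqx0 hzero)

theorem tendsto_flow_FL_of_fst_mem_Icc (h : Admissible γ lam) (hp : p ∈ interiorStates)
    (hpS : p ≠ S γ lam)
    (hx : ∀ᶠ t in atBot, (flow γ lam t p).1 ∈ Set.Icc 0 (S γ lam).1) :
    Tendsto (flow γ lam · p) atBot (𝓝 FL) := by
  have hsq : ∀ a ∈ Set.Icc 0 (S γ lam).1, 0 < 1 - a ^ 2 := fun a ha => by
    nlinarith [ha.1, ha.2, h.S_fst_lt_one]
  refine tendsto_flow_atBot_of_fst_mem_Icc h hp hpS hx (fun a ha haz => ?_) fun a ha haz => ?_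
  · exact absurd haz (mul_pos (hsq a ha) (by linarith [ha.2, h.S_fst_lt_P_fst])).ne'
  · rw [(mul_eq_zero.1 haz).resolve_left (hsq a ha).ne', FL]
    norm_num

theorem tendsto_flow_P_of_fst_mem_Icc (h : Admissible γ lam) (hP : (P lam).1 < 1)
    (hp : p ∈ interiorStates) (hpS : p ≠ S γ lam)
    (hx : ∀ᶠ t in atBot, (flow γ lam t p).1 ∈ Set.Icc (S γ lam).1 (P lam).1) :
    Tendsto (flow γ lam · p) atBot (𝓝 (P lam)) := by
  have hpos : ∀ a ∈ Set.Icc (S γ lam).1 (P lam).1, 0 < a := fun a ha =>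
    h.S_fst_pos.trans_le ha.1
  have hsq : ∀ a ∈ Set.Icc (S γ lam).1 (P lam).1, 0 < 1 - a ^ 2 := fun a ha => by
    nlinarith [hpos a ha, ha.2]
  refine tendsto_flow_atBot_of_fst_mem_Icc h hp hpS hx (fun a ha haz => ?_) fun a ha haz => ?_
  · rw [← sub_eq_zero.1 ((mul_eq_zero.1 haz).resolve_left (hsq a ha).ne'), P]
  · exact absurd haz (mul_pos (hsq a ha) (hpos a ha)).ne'

theorem tendsto_flow_Kplus_of_fst_mem_Icc (h : Admissible γ lam) (hp : p ∈ interiorStates)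
    (hpS : p ≠ S γ lam) (hl : 0 < l) (hlP : l ≤ (P lam).1 → 1 ≤ (P lam).1)
    (hx : ∀ᶠ t in atBot, (flow γ lam t p).1 ∈ Set.Icc l 1) :
    Tendsto (flow γ lam · p) atBot (𝓝 Kplus) := by
  have hpos : ∀ a ∈ Set.Icc l 1, 0 < a := fun a ha => hl.trans_le ha.1
  have hone : ∀ a ∈ Set.Icc l 1, 1 - a ^ 2 = 0 → a = 1 := fun a ha haz => by
    nlinarith [hpos a ha]
  refine tendsto_flow_atBot_of_fst_mem_Icc h hp hpS hx (fun a ha haz => ?_) fun a ha haz => ?_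
  · rcases mul_eq_zero.1 haz with haz | haz
    · rw [hone a ha haz, Kplus]
    · rw [Kplus, le_antisymm ha.2 (by linarith [hlP (by linarith [ha.1])])]
  · rw [hone a ha ((mul_eq_zero.1 haz).resolve_right (hpos a ha).ne'), Kplus]
    norm_num

theorem fst_flow_mem_Icc (hp : p ∈ interiorStates) (t : ℝ) :
    (flow γ lam t p).1 ∈ Set.Icc (-1) 1 :=
  fst_mem_Icc_of_mem_stateSpace (isInvariant_stateSpace γ lam t
    (interiorStates_subset_stateSpace hp))

theorem field_fst_pos_of_fst_nonpos (h : Admissible γ lam) (hq : q ∈ interiorStates)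
    (hx : q.1 ≤ 0) : 0 < (field γ lam q).1 := by
  obtain ⟨hx1, -⟩ := fst_mem_Ioo_of_mem_interiorStates hq
  have hV := mul_pos (mul_pos h.P_fst_pos
    (h.one_sub_S_fst_mul_fst_pos (interiorStates_subset_stateSpace hq))) hq.1
  have hdrift : 0 ≤ (3 - 3 / 2 * γ) * (1 - q.1 ^ 2) * -q.1 :=
    mul_nonneg (mul_nonneg (by linarith [h.γ_lt_two]) (by nlinarith)) (neg_nonneg.2 hx)
  rw [h.field_fst_eq_add_OmegaV]
  linarith

theorem field_fst_neg_of_P_fst_le (h : Admissible γ lam) (hq : q ∈ interiorStates)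
    (hx : (P lam).1 ≤ q.1) : (field γ lam q).1 < 0 := by
  obtain ⟨hx1, hx2⟩ := fst_mem_Ioo_of_mem_interiorStates hq
  have hy := mul_pos (mul_pos h.P_fst_pos
    (h.one_sub_S_fst_mul_fst_pos (interiorStates_subset_stateSpace hq))) hq.2
  have hdrift : 0 ≤ (1 - q.1 ^ 2) * (q.1 - (P lam).1) :=
    mul_nonneg (by nlinarith) (sub_nonneg.2 hx)
  rw [h.field_fst]
  linarith

theorem tendsto_flow_Kminus_of_fst_nonpos (h : Admissible γ lam) (hp : p ∈ interiorStates)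
    (hx : p.1 ≤ 0) : Tendsto (flow γ lam · p) atBot (𝓝 Kminus) := by
  have hpS : p ≠ S γ lam := fun hS => (hS ▸ hx).not_gt h.S_fst_pos
  have hlt : ∀ {s t}, (flow γ lam t p).1 ≤ 0 → s < t → (flow γ lam s p).1 < (flow γ lam t p).1 :=
    lt_of_deriv_pos_of_le (hasDerivAt_fst_flow (interiorStates_subset_stateSpace hp))
      fun t => field_fst_pos_of_fst_nonpos h (isInvariant_interiorStates γ lam t hp)
  have hneg : (flow γ lam (-1) p).1 < 0 := by
    have h0 := hlt (s := -1) (t := 0) (by rwa [(flow γ lam).map_zero_apply]) (by norm_num)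
    rw [(flow γ lam).map_zero_apply] at h0
    exact h0.trans_le hx
  have hone : ∀ a ∈ Set.Icc (-1) (flow γ lam (-1) p).1, 1 - a ^ 2 = 0 → a = -1 :=
    fun a ha haz => by nlinarith [ha.1, ha.2]
  refine tendsto_flow_atBot_of_fst_mem_Icc (l := -1) (u := (flow γ lam (-1) p).1) h hp hpS ?_
    (fun a ha haz => ?_) fun a ha haz => ?_
  · filter_upwards [eventually_lt_atBot (-1)] with t ht
    exact ⟨(fst_flow_mem_Icc hp t).1, (hlt hneg.le ht).le⟩
  · rw [hone a ha ((mul_eq_zero.1 haz).resolve_right (by linarith [ha.2, h.P_fst_pos])), Kminus]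
  · rw [hone a ha ((mul_eq_zero.1 haz).resolve_right (by linarith [ha.2])), Kminus]
    norm_num

theorem tendsto_flow_Kplus_of_P_fst_le (h : Admissible γ lam) (hp : p ∈ interiorStates)
    (hx : (P lam).1 ≤ p.1) : Tendsto (flow γ lam · p) atBot (𝓝 Kplus) := by
  have hpS : p ≠ S γ lam := fun hS => (hS ▸ hx).not_gt h.S_fst_lt_P_fst
  have hlt : ∀ {s t}, -(flow γ lam t p).1 ≤ -(P lam).1 → s < t →
      -(flow γ lam s p).1 < -(flow γ lam t p).1 :=
    lt_of_deriv_pos_of_le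
      (fun t => (hasDerivAt_fst_flow (interiorStates_subset_stateSpace hp) t).neg)
      fun t ht => neg_pos.2 (field_fst_neg_of_P_fst_le h
        (isInvariant_interiorStates γ lam t hp) (neg_le_neg_iff.1 ht))
  have hgt : (P lam).1 < (flow γ lam (-1) p).1 := by
    have h0 := hlt (s := -1) (t := 0)
      (by rwa [(flow γ lam).map_zero_apply, neg_le_neg_iff]) (by norm_num)
    rw [(flow γ lam).map_zero_apply] at h0
    linarith
  refine tendsto_flow_Kplus_of_fst_mem_Icc h hp hpS (h.P_fst_pos.trans hgt)
    (fun hle => absurd hle hgt.not_ge) ?_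
  filter_upwards [eventually_lt_atBot (-1)] with t ht
  exact ⟨(neg_lt_neg_iff.1 (hlt (neg_le_neg hgt.le) ht)).le, (fst_flow_mem_Icc hp t).2⟩

end AlphaLimit

section LargeSlope

variable {γ lam l : ℝ} {p q : ℝ × ℝ}

/-- The logarithm of `Ω_pf / Ω_V`, which increases along an interior orbit exactly while `Σ_φ`
exceeds its value at `S γ lam`. -/
noncomputable def logRatio (q : ℝ × ℝ) : ℝ := Real.log q.2 - Real.log (OmegaV q)

theorem continuousAt_logRatio (hq : q ∈ interiorStates) : ContinuousAt logRatio q :=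
  (continuousAt_snd.log hq.2.ne').sub (continuous_OmegaV.continuousAt.log hq.1.ne')

theorem hasDerivAt_logRatio_flow (h : Admissible γ lam) (hp : p ∈ interiorStates) (t : ℝ) :
    HasDerivAt (fun t => logRatio (flow γ lam t p))
      (6 * (P lam).1 * ((flow γ lam t p).1 - (S γ lam).1)) t := by
  have hp' := interiorStates_subset_stateSpace hp
  obtain ⟨hV, hy⟩ := isInvariant_interiorStates γ lam t hp
  have hd := ((hasDerivAt_snd_flow hp' t).log hy.ne').sub
    ((hasDerivAt_OmegaV_flow hp' t).log hV.ne')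
  rw [field, mul_div_cancel_right₀ _ hy.ne', mul_div_cancel_right₀ _ hV.ne'] at hd
  exact hd.congr_deriv (by linear_combination 3 * h.two_mul_P_fst_mul_S_fst)

theorem tendsto_logRatio_flow_atBot (h : Admissible γ lam) (hp : p ∈ interiorStates)
    (hl : (S γ lam).1 < l) (hx : ∀ᶠ t in atBot, l ≤ (flow γ lam t p).1) :
    Tendsto (fun t => logRatio (flow γ lam t p)) atBot atBot := by
  obtain ⟨T, hT⟩ := eventually_atBot.1 hx
  exact tendsto_atBot_of_le_deriv (hasDerivAt_logRatio_flow h hp)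
    (mul_pos (mul_pos (by norm_num) h.P_fst_pos) (sub_pos.2 hl)) fun t ht =>
      mul_le_mul_of_nonneg_left (sub_le_sub_right (hT t ht) _) (by linarith [h.P_fst_pos])

theorem OmegaV_rate_nonpos (h : Admissible γ lam) (hP : 1 ≤ (P lam).1) (hq : q ∈ stateSpace)
    (hx : (S γ lam).1 ≤ q.1) (hy : γ * q.2 ≤ (S γ lam).1 * OmegaV q) :
    2 * (1 + decel γ q) - 6 * (P lam).1 * q.1 ≤ 0 := by
  have hx0 := h.S_fst_pos.trans_le hx
  have hsum : 1 - q.1 ^ 2 = OmegaV q + q.2 := by rw [OmegaV]; ring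
  have hfluid : γ * q.2 ≤ q.1 * (1 - q.1 ^ 2) := by
    rw [hsum]
    nlinarith [mul_le_mul_of_nonneg_right hx hq.1, mul_nonneg hx0.le hq.2]
  have hslope : q.1 ≤ (P lam).1 * q.1 := le_mul_of_one_le_left hx0.le hP
  rw [decel]
  nlinarith [mul_nonneg hx0.le (sq_nonneg (1 - q.1))]

theorem not_tendsto_flow_Kplus (h : Admissible γ lam) (hP : 1 ≤ (P lam).1)
    (hp : p ∈ interiorStates) : ¬ Tendsto (flow γ lam · p) atBot (𝓝 Kplus) := by
  intro hK
  have hp' := interiorStates_subset_stateSpace hp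
  obtain ⟨l, hσl, hl1⟩ := exists_between h.S_fst_lt_one
  have hx : ∀ᶠ t in atBot, l < (flow γ lam t p).1 :=
    (continuous_fst.continuousAt.tendsto.comp hK).eventually_const_lt hl1
  have hratio := (tendsto_logRatio_flow_atBot h hp hσl
    (hx.mono fun _ => le_of_lt)).eventually_le_atBot (Real.log ((S γ lam).1 / γ))
  obtain ⟨T, hT⟩ := eventually_atBot.1 (hx.and hratio)
  have hrate : ∀ t ≤ T,
      2 * (1 + decel γ (flow γ lam t p)) - 6 * (P lam).1 * (flow γ lam t p).1 ≤ 0 := by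
    intro t ht
    obtain ⟨hV, hy⟩ := isInvariant_interiorStates γ lam t hp
    have hle := (hT t ht).2
    rw [logRatio, ← Real.log_div hy.ne' hV.ne', Real.log_le_log_iff (div_pos hy hV)
      (div_pos h.S_fst_pos h.γ_pos), div_le_div_iff₀ hV h.γ_pos, mul_comm _ γ] at hle
    exact OmegaV_rate_nonpos h hP (isInvariant_stateSpace γ lam t hp')
      (hσl.trans (hT t ht).1).le hle
  have hVle : ∀ t ≤ T, OmegaV (flow γ lam T p) ≤ OmegaV (flow γ lam t p) := fun t ht => by
    have hsub := mul_sub_le_sub_of_le_deriv (ε := 0)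
      (fun s => (hasDerivAt_OmegaV_flow hp' s).neg) ht
      fun s hs => neg_nonneg.2 (mul_nonpos_of_nonpos_of_nonneg (hrate s hs.2)
        (isInvariant_interiorStates γ lam s hp).1.le)
    simp only [Pi.neg_apply] at hsub
    linarith
  have hlim : Tendsto (fun t => OmegaV (flow γ lam t p)) atBot (𝓝 (OmegaV Kplus)) :=
    (continuous_OmegaV.tendsto _).comp hK
  have hle := ge_of_tendsto hlim ((eventually_le_atBot T).mono hVle)
  have hV := (isInvariant_interiorStates γ lam T hp).1
  norm_num [OmegaV, Kplus] at hle hV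
  linarith

theorem tendsto_OmegaV_flow_of_one_le_P_fst (h : Admissible γ lam) (hP : 1 ≤ (P lam).1)
    (hp : p ∈ interiorStates) (hpS : p ≠ S γ lam) (hx : ∀ t, 0 < (flow γ lam t p).1) :
    Tendsto (fun t => OmegaV (flow γ lam t p)) atBot (𝓝 0) := by
  have hp' := interiorStates_subset_stateSpace hp
  refine tendsto_comp_of_forall_mapClusterPt isCompact_stateSpace
    (.of_forall fun t => isInvariant_stateSpace γ lam t hp') continuous_OmegaV fun q hq hcl => ?_
  refine (snd_eq_zero_or_OmegaV_eq_zero hq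
    (not_mem_interiorStates_of_mapClusterPt_atBot h hp hpS hcl)).elim (fun hq0 => ?_) id
  have hqx := fst_mem_Icc_flow_of_mapClusterPt (l := 0) (u := 1)
    (.of_forall fun t => ⟨(hx t).le, (fst_flow_mem_Icc hp t).2⟩) hcl
  have hone : ∀ a ∈ Set.Icc (0 : ℝ) 1, (1 - a ^ 2) * ((P lam).1 - a) = 0 → a = 1 := by
    rintro a ⟨ha0, ha1⟩ haz
    rcases mul_eq_zero.1 haz with haz | haz <;> nlinarith
  have hq1 := hone q.1 (by simpa only [(flow γ lam).map_zero_apply] using hqx 0) <|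
    zero_of_mem_invariantCore_snd_eq_zero h
      (fun a ha b hb haz hbz => (hone a ha haz).trans (hone b hb hbz).symm)
      fun t => ⟨isInvariant_stateSpace γ lam t hq, snd_flow_eq_zero hq0 t, hqx t⟩
  rw [OmegaV, hq1, hq0]
  norm_num

theorem tendsto_flow_FL_of_one_le_P_fst (h : Admissible γ lam) (hP : 1 ≤ (P lam).1)
    (hp : p ∈ interiorStates) (hpS : p ≠ S γ lam) (hx : ∀ t, 0 < (flow γ lam t p).1) :
    Tendsto (flow γ lam · p) atBot (𝓝 FL) := by
  have hp' := interiorStates_subset_stateSpace hp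
  have hsq : 0 < 1 - (S γ lam).1 ^ 2 := by nlinarith [h.S_fst_pos, h.S_fst_lt_one]
  have hdrift : 0 < (3 - 3 / 2 * γ) * (1 - (S γ lam).1 ^ 2) * (S γ lam).1 :=
    mul_pos (mul_pos (by linarith [h.γ_lt_two]) hsq) h.S_fst_pos
  have hlim : Tendsto (fun t => 3 * (P lam).1 * (1 - (S γ lam).1 * (S γ lam).1)
      * OmegaV (flow γ lam t p)) atBot (𝓝 0) := by
    simpa only [mul_zero] using
      (tendsto_OmegaV_flow_of_one_le_P_fst h hP hp hpS hx).const_mul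
        (3 * (P lam).1 * (1 - (S γ lam).1 * (S γ lam).1))
  -- Where `Ω_V` is small, `Σ_φ` can cross the value it has at `S` only downwards.
  obtain ⟨T, hT⟩ := eventually_atBot.1 (hlim.eventually_lt_const hdrift)
  have hcross : ∀ t ≤ T, (flow γ lam t p).1 = (S γ lam).1 →
      (field γ lam (flow γ lam t p)).1 < 0 := fun t ht heq => by
    rw [h.field_fst_eq_add_OmegaV, heq]
    exact sub_neg.2 (hT t ht)
  by_cases hle : ∀ t ≤ T, (flow γ lam t p).1 ≤ (S γ lam).1
  · refine tendsto_flow_FL_of_fst_mem_Icc h hp hpS ?_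
    filter_upwards [eventually_le_atBot T] with t ht using ⟨(hx t).le, hle t ht⟩
  · push Not at hle
    obtain ⟨t₀, ht₀, hlt⟩ := hle
    refine absurd (tendsto_flow_Kplus_of_fst_mem_Icc h hp hpS h.S_fst_pos (fun _ => hP) ?_)
      (not_tendsto_flow_Kplus h hP hp)
    filter_upwards [eventually_le_atBot t₀] with t ht
    exact ⟨ge_of_deriv_neg_at_level (hasDerivAt_fst_flow hp') ht hlt.le
      fun s hs => hcross s (hs.2.trans ht₀), (fst_flow_mem_Icc hp t).2⟩

end LargeSlope

section Shooting

variable {γ lam l u w ξ : ℝ} {p q : ℝ × ℝ}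

/-- The interior state with `Σ_φ = ξ` and `logRatio` equal to `w`, for `ξ ∈ (-1, 1)`. -/
noncomputable def ofLogRatio (ξ w : ℝ) : ℝ × ℝ := (ξ, Real.sigmoid w * (1 - ξ ^ 2))

theorem OmegaV_ofLogRatio (ξ w : ℝ) :
    OmegaV (ofLogRatio ξ w) = Real.sigmoid (-w) * (1 - ξ ^ 2) := by
  rw [OmegaV, ofLogRatio, Real.sigmoid_neg]
  ring

theorem ofLogRatio_mem_interiorStates (hξ : 0 < 1 - ξ ^ 2) (w : ℝ) :
    ofLogRatio ξ w ∈ interiorStates :=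
  ⟨OmegaV_ofLogRatio ξ w ▸ mul_pos (Real.sigmoid_pos _) hξ, mul_pos (Real.sigmoid_pos _) hξ⟩

theorem logRatio_ofLogRatio (hξ : 0 < 1 - ξ ^ 2) (w : ℝ) : logRatio (ofLogRatio ξ w) = w := by
  have hpos := Real.sigmoid_pos
  rw [logRatio, OmegaV_ofLogRatio, ofLogRatio, Real.log_mul (hpos w).ne' hξ.ne',
    Real.log_mul (hpos (-w)).ne' hξ.ne', ← Real.sigmoid_mul_rexp_neg,
    Real.log_mul (hpos w).ne' (Real.exp_pos _).ne', Real.log_exp]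
  ring

theorem one_sub_fst_sq_pos (hq : q ∈ interiorStates) : 0 < 1 - q.1 ^ 2 := by
  have := hq.1
  rw [OmegaV] at this
  linarith [hq.2]

theorem ofLogRatio_logRatio (hq : q ∈ interiorStates) : ofLogRatio q.1 (logRatio q) = q := by
  have hsq := one_sub_fst_sq_pos hq
  obtain ⟨w, hw⟩ : q.2 / (1 - q.1 ^ 2) ∈ Set.range Real.sigmoid := by
    rw [Real.range_sigmoid]
    exact ⟨div_pos hq.2 hsq, (div_lt_one hsq).2 (sub_pos.1 hq.1)⟩
  have hqw : q = ofLogRatio q.1 w :=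
    Prod.ext rfl (by rw [ofLogRatio, hw, div_mul_cancel₀ _ hsq.ne'])
  rw [hqw, logRatio_ofLogRatio hsq]
  rfl

theorem snd_lt_snd_of_logRatio_lt (hp : p ∈ interiorStates) (hq : q ∈ interiorStates)
    (hfst : p.1 = q.1) (hlt : logRatio p < logRatio q) : p.2 < q.2 := by
  rw [← ofLogRatio_logRatio hp, ← ofLogRatio_logRatio hq, hfst]
  exact mul_lt_mul_of_pos_right (Real.sigmoid_lt hlt) (one_sub_fst_sq_pos hq)

theorem field_fst_of_fst_eq (h : Admissible γ lam) (hx : q.1 = (S γ lam).1) :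
    (field γ lam q).1 = 3 * (P lam).1 * (1 - (S γ lam).1 ^ 2) * ((S γ lam).2 - q.2) := by
  rw [h.field_fst, hx]
  linear_combination (-3) * (1 - (S γ lam).1 ^ 2) * h.P_fst_mul_S_snd

theorem three_mul_P_fst_mul_pos (h : Admissible γ lam) :
    0 < 3 * (P lam).1 * (1 - (S γ lam).1 ^ 2) :=
  mul_pos (by linarith [h.P_fst_pos]) (one_sub_fst_sq_pos (S_mem_interiorStates h))

theorem field_fst_neg_of_logRatio_gt (h : Admissible γ lam) (hq : q ∈ interiorStates)
    (hx : q.1 = (S γ lam).1) (hlt : logRatio (S γ lam) < logRatio q) : (field γ lam q).1 < 0 := by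
  rw [field_fst_of_fst_eq h hx]
  exact mul_neg_of_pos_of_neg (three_mul_P_fst_mul_pos h)
    (sub_neg.2 (snd_lt_snd_of_logRatio_lt (S_mem_interiorStates h) hq hx.symm hlt))

theorem field_fst_pos_of_logRatio_lt (h : Admissible γ lam) (hq : q ∈ interiorStates)
    (hx : q.1 = (S γ lam).1) (hlt : logRatio q < logRatio (S γ lam)) : 0 < (field γ lam q).1 := by
  rw [field_fst_of_fst_eq h hx]
  exact mul_pos (three_mul_P_fst_mul_pos h)
    (sub_pos.2 (snd_lt_snd_of_logRatio_lt hq (S_mem_interiorStates h) hx hlt))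

theorem tendsto_logRatio_flow_atTop (h : Admissible γ lam) (hp : p ∈ interiorStates) :
    Tendsto (fun t => logRatio (flow γ lam t p)) atTop (𝓝 (logRatio (S γ lam))) :=
  (continuousAt_logRatio (S_mem_interiorStates h)).tendsto.comp (tendsto_flow_S h hp)

theorem continuous_logRatio_flow (h : Admissible γ lam) (hp : p ∈ interiorStates) :
    Continuous fun t => logRatio (flow γ lam t p) :=
  continuous_iff_continuousAt.2 fun t => (hasDerivAt_logRatio_flow h hp t).continuousAt

theorem exists_fst_flow_mem_Icc_zero_S_fst (h : Admissible γ lam) (hw : logRatio (S γ lam) < w)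
    (n : ℕ) : ∃ p ∈ interiorStates, logRatio p = w ∧
      ∀ t ∈ Set.Icc (-n : ℝ) 0, (flow γ lam t p).1 ∈ Set.Icc 0 (S γ lam).1 := by
  have hγn : 0 ≤ 3 * γ * n := mul_nonneg (by linarith [h.γ_pos]) n.cast_nonneg
  set q := ofLogRatio 0 (w + 3 * γ * n)
  have hq : q ∈ interiorStates := ofLogRatio_mem_interiorStates (by norm_num) _
  have hq0 : logRatio q = w + 3 * γ * n := logRatio_ofLogRatio (by norm_num) _
  have hx := hasDerivAt_fst_flow (γ := γ) (lam := lam) (interiorStates_subset_stateSpace hq)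
  have hqt := fun t => isInvariant_interiorStates γ lam t hq
  obtain ⟨T, hT, hTw, hwle⟩ := exists_first_crossing (c := w) (continuous_logRatio_flow h hq)
    (by rw [(flow γ lam).map_zero_apply, hq0]; linarith)
    ((tendsto_logRatio_flow_atTop h hq).eventually_lt_const hw)
  have hx0 : (flow γ lam 0 q).1 = 0 := by rw [(flow γ lam).map_zero_apply]; rfl
  have hge : ∀ t, 0 ≤ t → 0 ≤ (flow γ lam t q).1 := fun t ht =>
    ge_of_deriv_pos_at_level hx ht hx0.ge fun s _ hs =>
      field_fst_pos_of_fst_nonpos h (hqt s) hs.le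
  have hle : ∀ t ∈ Set.Icc 0 T, (flow γ lam t q).1 ≤ (S γ lam).1 := fun t ht =>
    le_of_deriv_neg_at_level hx ht.1 (hx0.le.trans h.S_fst_pos.le) fun s hs hsx =>
      field_fst_neg_of_logRatio_gt h (hqt s) hsx (hw.trans_le (hwle s ⟨hs.1, hs.2.le.trans ht.2⟩))
  have hnT : (n : ℝ) ≤ T := by
    have hrate := mul_sub_le_sub_of_le_deriv (ε := -(3 * γ)) (hasDerivAt_logRatio_flow h hq) hT
      fun t ht => by
        linarith [h.two_mul_P_fst_mul_S_fst, mul_nonneg h.P_fst_pos.le (hge t ht.1)]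
    rw [hTw, (flow γ lam).map_zero_apply, hq0] at hrate
    nlinarith [h.γ_pos]
  refine ⟨flow γ lam T q, hqt T, hTw, fun t ht => ?_⟩
  rw [← (flow γ lam).map_add]
  exact ⟨hge _ (by linarith [ht.1]), hle _ ⟨by linarith [ht.1], by linarith [ht.2]⟩⟩

theorem exists_fst_flow_mem_Icc_S_fst_P_fst (h : Admissible γ lam) (hP : (P lam).1 < 1)
    (hw : w < logRatio (S γ lam)) (n : ℕ) : ∃ p ∈ interiorStates, logRatio p = w ∧
      ∀ t ∈ Set.Icc (-n : ℝ) 0, (flow γ lam t p).1 ∈ Set.Icc (S γ lam).1 (P lam).1 := by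
  set ν := 6 * (P lam).1 * ((P lam).1 - (S γ lam).1)
  have hνpos : 0 < ν := mul_pos (by linarith [h.P_fst_pos]) (sub_pos.2 h.S_fst_lt_P_fst)
  have hsq : 0 < 1 - (P lam).1 ^ 2 := by nlinarith [h.P_fst_pos]
  set q := ofLogRatio (P lam).1 (w - ν * n)
  have hq : q ∈ interiorStates := ofLogRatio_mem_interiorStates hsq _
  have hq0 : logRatio q = w - ν * n := logRatio_ofLogRatio hsq _
  have hx := hasDerivAt_fst_flow (γ := γ) (lam := lam) (interiorStates_subset_stateSpace hq)
  have hqt := fun t => isInvariant_interiorStates γ lam t hq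
  obtain ⟨T, hT, hTw, hwle⟩ := exists_first_crossing (c := -w)
    (f := fun t => -logRatio (flow γ lam t q)) (continuous_logRatio_flow h hq).neg
    (by rw [(flow γ lam).map_zero_apply, hq0]; linarith [mul_nonneg hνpos.le n.cast_nonneg])
    ((tendsto_logRatio_flow_atTop h hq).neg.eventually_lt_const (neg_lt_neg hw))
  have hx0 : (flow γ lam 0 q).1 = (P lam).1 := by rw [(flow γ lam).map_zero_apply]; rfl
  have hle : ∀ t, 0 ≤ t → (flow γ lam t q).1 ≤ (P lam).1 := fun t ht =>
    le_of_deriv_neg_at_level hx ht hx0.le fun s _ hs =>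
      field_fst_neg_of_P_fst_le h (hqt s) hs.ge
  have hge : ∀ t ∈ Set.Icc 0 T, (S γ lam).1 ≤ (flow γ lam t q).1 := fun t ht =>
    ge_of_deriv_pos_at_level hx ht.1 (h.S_fst_lt_P_fst.le.trans hx0.ge) fun s hs hsx =>
      field_fst_pos_of_logRatio_lt h (hqt s) hsx
        ((neg_le_neg_iff.1 (hwle s ⟨hs.1, hs.2.le.trans ht.2⟩)).trans_lt hw)
  have hnT : (n : ℝ) ≤ T := by
    have hrate := mul_sub_le_sub_of_le_deriv (ε := -ν)
      (fun t => (hasDerivAt_logRatio_flow h hq t).neg) hT fun t ht =>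
        neg_le_neg (mul_le_mul_of_nonneg_left (sub_le_sub_right (hle t ht.1) _)
          (by linarith [h.P_fst_pos]))
    simp only [Pi.neg_apply, neg_inj] at hrate hTw
    rw [hTw, (flow γ lam).map_zero_apply, hq0] at hrate
    nlinarith
  refine ⟨flow γ lam T q, hqt T, neg_inj.1 hTw, fun t ht => ?_⟩
  rw [← (flow γ lam).map_add]
  exact ⟨hge _ ⟨by linarith [ht.1], by linarith [ht.2]⟩, hle _ (by linarith [ht.1])⟩

theorem continuous_fst_flow_ofLogRatio (γ lam w t : ℝ) :
    Continuous fun ξ => (flow γ lam t (ofLogRatio ξ w)).1 :=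
  continuous_fst.comp (((flow γ lam).continuous_toFun t).comp (by unfold ofLogRatio; fun_prop))

theorem exists_fst_flow_mem_Icc_of_forall_nat (hlu : Set.Icc l u ⊆ Set.Ioo (-1) 1)
    (hex : ∀ n : ℕ, ∃ p ∈ interiorStates, logRatio p = w ∧
      ∀ t ∈ Set.Icc (-n : ℝ) 0, (flow γ lam t p).1 ∈ Set.Icc l u) :
    ∃ p ∈ interiorStates, logRatio p = w ∧ ∀ t ≤ 0, (flow γ lam t p).1 ∈ Set.Icc l u := by
  set K : ℕ → Set ℝ := fun n =>
    ⋂ t ∈ Set.Icc (-n : ℝ) 0, {ξ | (flow γ lam t (ofLogRatio ξ w)).1 ∈ Set.Icc l u} with hK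
  have hmem : ∀ {n ξ}, ξ ∈ K n ↔
      ∀ t ∈ Set.Icc (-n : ℝ) 0, (flow γ lam t (ofLogRatio ξ w)).1 ∈ Set.Icc l u := by
    simp only [hK, Set.mem_iInter₂, Set.mem_ofPred_eq, implies_true]
  have hclosed : ∀ n, IsClosed (K n) := fun n => isClosed_biInter fun t _ =>
    isClosed_Icc.preimage (continuous_fst_flow_ofLogRatio γ lam w t)
  have hsub : ∀ n, K n ⊆ Set.Icc l u := fun n ξ hξ => by
    have h0 := hmem.1 hξ 0 ⟨neg_nonpos.2 n.cast_nonneg, le_rfl⟩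
    rwa [(flow γ lam).map_zero_apply] at h0
  obtain ⟨ξ, hξ⟩ := IsCompact.nonempty_iInter_of_sequence_nonempty_isCompact_isClosed K
    (fun n ξ hξ => hmem.2 fun t ht => hmem.1 hξ t
      ⟨(neg_le_neg (Nat.cast_le.2 n.le_succ)).trans ht.1, ht.2⟩)
    (fun n => by
      obtain ⟨p, hp, rfl, hpt⟩ := hex n
      exact ⟨p.1, hmem.2 (by rwa [ofLogRatio_logRatio hp])⟩)
    (isCompact_Icc.of_isClosed_subset (hclosed 0) (hsub 0)) hclosed
  rw [Set.mem_iInter] at hξ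
  obtain ⟨hξ1, hξ2⟩ := hlu (hsub 0 (hξ 0))
  have hsq : 0 < 1 - ξ ^ 2 := by nlinarith
  refine ⟨_, ofLogRatio_mem_interiorStates hsq w, logRatio_ofLogRatio hsq w, fun t ht => ?_⟩
  obtain ⟨n, hn⟩ := exists_nat_ge (-t)
  exact hmem.1 (hξ n) t ⟨neg_le.1 hn, ht⟩

theorem exists_tendsto_flow_FL (h : Admissible γ lam) :
    ∃ p ∈ interiorStates, Tendsto (flow γ lam · p) atBot (𝓝 FL) := by
  have hw := lt_add_one (logRatio (S γ lam))
  obtain ⟨p, hp, hpw, hpt⟩ := exists_fst_flow_mem_Icc_of_forall_nat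
    (fun ξ hξ => ⟨by linarith [hξ.1], hξ.2.trans_lt h.S_fst_lt_one⟩)
    (exists_fst_flow_mem_Icc_zero_S_fst h hw)
  exact ⟨p, hp, tendsto_flow_FL_of_fst_mem_Icc h hp (fun hS => hw.ne (hS ▸ hpw))
    ((eventually_le_atBot 0).mono hpt)⟩

theorem exists_tendsto_flow_P (h : Admissible γ lam) (hP : (P lam).1 < 1) :
    ∃ p ∈ interiorStates, Tendsto (flow γ lam · p) atBot (𝓝 (P lam)) := by
  have hw := sub_one_lt (logRatio (S γ lam))
  obtain ⟨p, hp, hpw, hpt⟩ := exists_fst_flow_mem_Icc_of_forall_nat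
    (fun ξ hξ => ⟨by linarith [hξ.1, h.S_fst_pos], hξ.2.trans_lt hP⟩)
    (exists_fst_flow_mem_Icc_S_fst_P_fst h hP hw)
  exact ⟨p, hp, tendsto_flow_P_of_fst_mem_Icc h hP hp (fun hS => hw.ne' (hS ▸ hpw))
    ((eventually_le_atBot 0).mono hpt)⟩

end Shooting

section Orbits

variable {γ lam ξ σ : ℝ} {p q : ℝ × ℝ} {O : Set (ℝ × ℝ)}

theorem fderiv_field_apply (γ lam : ℝ) (p d : ℝ × ℝ) : fderiv ℝ (field γ lam) p d =
    ((-3 + 9 * p.1 ^ 2 + 3 / 2 * γ * p.2 - 6 * (P lam).1 * p.1) * d.1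
      + (3 / 2 * γ * p.1 - 3 * (P lam).1) * d.2,
      12 * p.1 * p.2 * d.1 + (6 * p.1 ^ 2 + 6 * γ * p.2 - 3 * γ) * d.2) := by
  have hx : HasFDerivAt Prod.fst (ContinuousLinearMap.fst ℝ ℝ ℝ) p := hasFDerivAt_fst
  have hy : HasFDerivAt Prod.snd (ContinuousLinearMap.snd ℝ ℝ ℝ) p := hasFDerivAt_snd
  have hdecel := (((hx.pow 2).const_mul 3).const_add (-1)).add (hy.const_mul (3 / 2 * γ))
  have hOmegaV := ((hx.pow 2).const_sub 1).sub hy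
  have hfield : HasFDerivAt (field γ lam) _ p :=
    (((hdecel.const_sub 2).neg.mul hx).add (hOmegaV.const_mul (√(3 / 2) * lam))).prodMk
      ((((hdecel.const_add 1).const_mul 2).sub_const (3 * γ)).mul hy)
  rw [hfield.fderiv, sqrt_mul_eq_three_mul_P_fst]
  ext <;>
    simp only [Pi.add_apply, Pi.neg_apply, Nat.add_one_sub_one, pow_one, nsmul_eq_mul,
      Nat.cast_ofNat, smul_add, ContinuousLinearMap.prod_apply, add_apply, smul_apply,
      ContinuousLinearMap.coe_fst', smul_eq_mul, ContinuousLinearMap.coe_snd', sub_apply,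
      neg_apply] <;>
    ring

theorem orbit_flow_eq_of_mem (h : p ∈ (flow γ lam).orbit q) :
    (flow γ lam).orbit p = (flow γ lam).orbit q :=
  let _ := (flow γ lam).toAddAction
  AddAction.orbit_eq_iff.2 h

theorem orbit_flow_subset_interiorStates (γ lam : ℝ) (hp : p ∈ interiorStates) :
    (flow γ lam).orbit p ⊆ interiorStates :=
  Set.range_subset_iff.2 fun t => isInvariant_interiorStates γ lam t hp

theorem IsSolution.eq_flow_of_range_subset {z : ℝ → ℝ × ℝ} (hz : IsSolution γ lam z)
    (hmem : Set.range z ⊆ interiorStates) : z = (flow γ lam · (z 0)) :=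
  hz.eq_flow fun t => interiorStates_subset_stateSpace (hmem ⟨t, rfl⟩)

theorem isInteriorOrbit_iff :
    IsInteriorOrbit γ lam O ↔ ∃ p ∈ interiorStates, O = (flow γ lam).orbit p := by
  constructor
  · rintro ⟨z, hz, rfl, hmem⟩
    exact ⟨z 0, hmem ⟨0, rfl⟩, congrArg Set.range (hz.eq_flow_of_range_subset hmem)⟩
  · rintro ⟨p, hp, rfl⟩
    exact ⟨_, isSolution_flow (interiorStates_subset_stateSpace hp), rfl,
      orbit_flow_subset_interiorStates γ lam hp⟩

theorem mem_interiorOrbitsFrom_iff : O ∈ interiorOrbitsFrom γ lam q ↔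
    ∃ p ∈ interiorStates, O = (flow γ lam).orbit p ∧ Tendsto (flow γ lam · p) atBot (𝓝 q) := by
  constructor
  · rintro ⟨⟨-, -, -, hmem⟩, z, hz, rfl, hlim⟩
    have hflow := hz.eq_flow_of_range_subset hmem
    exact ⟨z 0, hmem ⟨0, rfl⟩, congrArg Set.range hflow, hflow ▸ hlim⟩
  · rintro ⟨p, hp, rfl, hlim⟩
    exact ⟨isInteriorOrbit_iff.2 ⟨p, hp, rfl⟩, _,
      isSolution_flow (interiorStates_subset_stateSpace hp), rfl, hlim⟩

theorem existsUnique_interiorOrbit (γ lam : ℝ) (hp : p ∈ interiorStates) :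
    ∃! O : Set (ℝ × ℝ), IsInteriorOrbit γ lam O ∧ p ∈ O := by
  refine ⟨_, ⟨isInteriorOrbit_iff.2 ⟨p, hp, rfl⟩, (flow γ lam).mem_orbit_self p⟩, ?_⟩
  rintro O ⟨hO, hpO⟩
  obtain ⟨q, -, rfl⟩ := isInteriorOrbit_iff.1 hO
  exact (orbit_flow_eq_of_mem hpO).symm

theorem endsAt_S (h : Admissible γ lam) (hO : IsInteriorOrbit γ lam O) :
    EndsAt γ lam O (S γ lam) := by
  obtain ⟨p, hp, rfl⟩ := isInteriorOrbit_iff.1 hO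
  exact ⟨_, isSolution_flow (interiorStates_subset_stateSpace hp), rfl, tendsto_flow_S h hp⟩

theorem existsUnique_interiorOrbit_from_saddle (hp : p.1 * p.2 = 0)
    (hstable : -3 + 9 * p.1 ^ 2 + 3 / 2 * γ * p.2 - 6 * (P lam).1 * p.1 < 0)
    (hunstable : 0 < 6 * p.1 ^ 2 + 6 * γ * p.2 - 3 * γ)
    (hside : ∀ q ∈ interiorStates, σ * p.2 < σ * q.2)
    (hex : ∃ q ∈ interiorStates, Tendsto (flow γ lam · q) atBot (𝓝 p)) :
    ∃! O : Set (ℝ × ℝ), O ∈ interiorOrbitsFrom γ lam p := by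
  obtain ⟨q, hq, hlim⟩ := hex
  refine ⟨_, mem_interiorOrbitsFrom_iff.2 ⟨q, hq, rfl, hlim⟩, fun O hO => ?_⟩
  obtain ⟨q', hq', rfl, hlim'⟩ := mem_interiorOrbitsFrom_iff.1 hO
  obtain ⟨t', t, heq⟩ := exists_eq_of_tendsto_saddle
    ((contDiff_field γ lam).contDiffAt.hasStrictFDerivAt one_ne_zero)
    (fun d => by rw [fderiv_field_apply, mul_assoc 12, hp, neg_neg, mul_zero, zero_mul, zero_add])
    (neg_pos.2 hstable) hunstable
    (hasDerivAt_flow (interiorStates_subset_stateSpace hq'))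
    (hasDerivAt_flow (interiorStates_subset_stateSpace hq)) hlim' hlim
    (fun t => hside _ (isInvariant_interiorStates γ lam t hq'))
    (fun t => hside _ (isInvariant_interiorStates γ lam t hq))
  rw [← orbit_flow_eq_of_mem ((flow γ lam).mem_orbit q' t'), heq,
    orbit_flow_eq_of_mem ((flow γ lam).mem_orbit q t)]

theorem existsUnique_interiorOrbit_from_FL (h : Admissible γ lam) :
    ∃! O : Set (ℝ × ℝ), O ∈ interiorOrbitsFrom γ lam FL :=
  existsUnique_interiorOrbit_from_saddle (σ := -1) (by simp [FL])
    (by simp only [FL]; linarith [h.γ_lt_two]) (by simp only [FL]; linarith [h.γ_pos])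
    (fun q hq => by
      have := hq.1
      rw [OmegaV] at this
      simp only [FL]
      nlinarith)
    (exists_tendsto_flow_FL h)

theorem existsUnique_interiorOrbit_from_P (h : Admissible γ lam) (hP : (P lam).1 < 1) :
    ∃! O : Set (ℝ × ℝ), O ∈ interiorOrbitsFrom γ lam (P lam) := by
  have hsnd : (P lam).2 = 0 := rfl
  refine existsUnique_interiorOrbit_from_saddle (σ := 1) (by rw [hsnd, mul_zero]) ?_ ?_ ?_
    (exists_tendsto_flow_P h hP)
  · rw [hsnd]
    nlinarith [h.P_fst_pos]
  · rw [hsnd]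
    nlinarith [h.two_mul_P_fst_mul_S_fst, mul_pos h.P_fst_pos (sub_pos.2 h.S_fst_lt_P_fst)]
  · intro q hq
    linarith [hq.2]

theorem isOneParameterSet_of_section (hξ : 0 < 1 - ξ ^ 2)
    (hfrom : ∀ p ∈ interiorStates, p.1 = ξ → Tendsto (flow γ lam · p) atBot (𝓝 q))
    (hcross : ∀ p ∈ interiorStates, Tendsto (flow γ lam · p) atBot (𝓝 q) →
      ∃! t, (flow γ lam t p).1 = ξ) :
    IsOneParameterSet (interiorOrbitsFrom γ lam q) := by
  refine ⟨ofLogRatio ξ, by unfold ofLogRatio; fun_prop, fun w => ?_, fun O hO => ?_⟩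
  · have hmem := ofLogRatio_mem_interiorStates hξ w
    exact ⟨_, mem_interiorOrbitsFrom_iff.2 ⟨_, hmem, rfl, hfrom _ hmem rfl⟩,
      (flow γ lam).mem_orbit_self _⟩
  · obtain ⟨p, hp, rfl, hlim⟩ := mem_interiorOrbitsFrom_iff.1 hO
    obtain ⟨t, ht, huniq⟩ := hcross p hp hlim
    refine ⟨logRatio (flow γ lam t p), ⟨t, ?_⟩, ?_⟩
    · exact (ht ▸ ofLogRatio_logRatio (isInvariant_interiorStates γ lam t hp)).symm
    · rintro w ⟨t', ht'⟩
      rw [← huniq t' (congrArg Prod.fst ht'), ← logRatio_ofLogRatio hξ w]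
      exact congrArg logRatio ht'.symm

theorem isOneParameterSet_Kminus (h : Admissible γ lam) :
    IsOneParameterSet (interiorOrbitsFrom γ lam Kminus) := by
  refine isOneParameterSet_of_section (ξ := 0) (by norm_num)
    (fun p hp hx => tendsto_flow_Kminus_of_fst_nonpos h hp hx.le) fun p hp hlim => ?_
  obtain ⟨s, hs⟩ := (hlim.fst_nhds.eventually_lt_const (neg_one_lt_zero (R := ℝ))).exists
  obtain ⟨t, ht⟩ := ((tendsto_flow_S h hp).fst_nhds.eventually_const_lt h.S_fst_pos).exists
  exact existsUnique_eq_of_deriv_pos_of_le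
    (hasDerivAt_fst_flow (interiorStates_subset_stateSpace hp))
    (fun u hu => field_fst_pos_of_fst_nonpos h (isInvariant_interiorStates γ lam u hp) hu)
    hs.le ht.le

theorem isOneParameterSet_Kplus (h : Admissible γ lam) (hP : (P lam).1 < 1) :
    IsOneParameterSet (interiorOrbitsFrom γ lam Kplus) := by
  refine isOneParameterSet_of_section (ξ := (P lam).1) (by nlinarith [h.P_fst_pos])
    (fun p hp hx => tendsto_flow_Kplus_of_P_fst_le h hp hx.ge) fun p hp hlim => ?_
  obtain ⟨s, hs⟩ := (hlim.fst_nhds.eventually_const_lt hP).exists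
  obtain ⟨t, ht⟩ :=
    ((tendsto_flow_S h hp).fst_nhds.eventually_lt_const h.S_fst_lt_P_fst).exists
  simpa only [Pi.neg_apply, neg_inj] using existsUnique_eq_of_deriv_pos_of_le
    (fun t => (hasDerivAt_fst_flow (interiorStates_subset_stateSpace hp) t).neg)
    (fun u hu => neg_pos.2 (field_fst_neg_of_P_fst_le h (isInvariant_interiorStates γ lam u hp)
      (neg_le_neg_iff.1 hu))) (neg_le_neg hs.le) (neg_le_neg ht.le)

theorem mem_interiorOrbitsFrom_Kminus (h : Admissible γ lam) (hP : 1 ≤ (P lam).1)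
    (hO : IsInteriorOrbit γ lam O) (hS : O ≠ {S γ lam}) (hFL : O ∉ interiorOrbitsFrom γ lam FL) :
    O ∈ interiorOrbitsFrom γ lam Kminus := by
  obtain ⟨p, hp, rfl⟩ := isInteriorOrbit_iff.1 hO
  obtain ⟨_, ⟨t, rfl⟩, htS⟩ : ∃ q ∈ (flow γ lam).orbit p, q ≠ S γ lam := by
    by_contra! hall
    exact hS ((Set.Nonempty.subset_singleton_iff ((flow γ lam).nonempty_orbit p)).1 hall)
  by_cases hx : ∃ s, (flow γ lam s p).1 ≤ 0
  · obtain ⟨s, hs⟩ := hx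
    have hq := isInvariant_interiorStates γ lam s hp
    exact mem_interiorOrbitsFrom_iff.2 ⟨_, hq,
      (orbit_flow_eq_of_mem ((flow γ lam).mem_orbit p s)).symm,
      tendsto_flow_Kminus_of_fst_nonpos h hq hs⟩
  · push Not at hx
    refine absurd (mem_interiorOrbitsFrom_iff.2 ⟨_, isInvariant_interiorStates γ lam t hp,
      (orbit_flow_eq_of_mem ((flow γ lam).mem_orbit p t)).symm,
      tendsto_flow_FL_of_one_le_P_fst h hP (isInvariant_interiorStates γ lam t hp) htS
        fun s => ?_⟩) hFL
    rw [← (flow γ lam).map_add]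
    exact hx _

theorem P_fst_lt_one_iff : (P lam).1 < 1 ↔ lam < √6 := div_lt_one (by positivity)

end Orbits

end ScalarFluid

/-- Global interior dynamics for `γ < λ²/3`. The first conjunct records that the interior is
partitioned into complete interior orbits; in the last one the stationary orbit `{S}` is excepted. -/
theorem theorem2 (γ lam : ℝ) (hγ₀ : 0 < γ) (hγ₂ : γ < 2) (hlam : 0 ≤ lam)
    (h : γ < lam ^ 2 / 3) :
    (∀ p ∈ ScalarFluid.interiorStates,
      ∃! O : Set (ℝ × ℝ), ScalarFluid.IsInteriorOrbit γ lam O ∧ p ∈ O) ∧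
    (∀ O : Set (ℝ × ℝ), ScalarFluid.IsInteriorOrbit γ lam O →
      ScalarFluid.EndsAt γ lam O (ScalarFluid.S γ lam)) ∧
    (∃! O : Set (ℝ × ℝ), O ∈ ScalarFluid.interiorOrbitsFrom γ lam ScalarFluid.FL) ∧
    ScalarFluid.IsOneParameterSet (ScalarFluid.interiorOrbitsFrom γ lam ScalarFluid.Kminus) ∧
    (lam < √6 →
      ScalarFluid.IsOneParameterSet (ScalarFluid.interiorOrbitsFrom γ lam ScalarFluid.Kplus) ∧
      ∃! O : Set (ℝ × ℝ),
        O ∈ ScalarFluid.interiorOrbitsFrom γ lam (ScalarFluid.P lam)) ∧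
    (√6 ≤ lam → ∀ O : Set (ℝ × ℝ), ScalarFluid.IsInteriorOrbit γ lam O →
      O ≠ {ScalarFluid.S γ lam} →
      O ∉ ScalarFluid.interiorOrbitsFrom γ lam ScalarFluid.FL →
      O ∈ ScalarFluid.interiorOrbitsFrom γ lam ScalarFluid.Kminus) := by
  have hadm : ScalarFluid.Admissible γ lam := ⟨hγ₀, hγ₂, hlam, h⟩
  refine ⟨fun p hp => ScalarFluid.existsUnique_interiorOrbit γ lam hp,
    fun O hO => ScalarFluid.endsAt_S hadm hO,
    ScalarFluid.existsUnique_interiorOrbit_from_FL hadm,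
    ScalarFluid.isOneParameterSet_Kminus hadm, fun hlt => ?_, fun hle O hO hS hFL => ?_⟩
  · have hP := ScalarFluid.P_fst_lt_one_iff.2 hlt
    exact ⟨ScalarFluid.isOneParameterSet_Kplus hadm hP,
      ScalarFluid.existsUnique_interiorOrbit_from_P hadm hP⟩
  · have hP := not_lt.1 (ScalarFluid.P_fst_lt_one_iff.not.2 hle.not_gt)
    exact ScalarFluid.mem_interiorOrbitsFrom_Kminus hadm hP hO hS hFL
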